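/- Let $n_x,n_u\in\mathbb N$, $A,B_1,\dots,B_{n_u}\in\mathbb R^{n_x\times n_x}$, $B_0\in\mathbb R^{n_x\times n_u}$, $\sigma_w>0$ and $\delta\in(0,1)$. Consider the bilinear system $$x^+ = A x + B_0 u + \sum_{i=1}^{n_u}[u]_i\,(B_i-A)\,x + w .$$ Perform $n_u+1$ experiments with constant inputs $u^0=0$ and $u^i=e_i$ (the $i$-th canonical basis vector) for $i=1,\dots,n_u$. In experiment $i$, states $x^{(i)}_1,\dots,x^{(i)}_{T_i}$ are sampled i.i.d. from an arbitrary distribution, independently of the noise $w^{(i)}_1,\dots,w^{(i)}_{T_i}\overset{\text{i.i.d.}}{\sim}\mathcal N(0,\sigma_w^2 I_{n_x})$, and the successor state $x^{(i)+}_t$ of each $x^{(i)}_t$ under the input $u^i$ and the noise $w^{(i)}_t$ is recorded. Put $y^{(i)}_t=\begin{bmatrix}(x^{(i)}_t)^\top & 1\end{bmatrix}^\top$ and let $\hat A$, $\hat B_0$, $\hat B_1,\dots,\hat B_{n_u}$ be any ordinary least squares estimates, that is, $$\hat A\in\arg\min_{A'}\sum_{t=1}^{T_0}\|x^{(0)+}_t-A'x^{(0)}_t\|_2^2,\qquad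 \begin{bmatrix}\hat B_i & [\hat B_0]_i\end{bmatrix}\in\arg\min_{\theta}\sum_{t=1}^{T_i}\|x^{(i)+}_t-\theta\, y^{(i)}_t\|_2^2\quad(i=1,\dots,n_u),$$ where $[\,\cdot\,]_i$ denotes the $i$-th column. Let $$M_0=\sum_{t=1}^{T_0}x^{(0)}_t (x^{(0)}_t)^\top,\qquad M_i=\sum_{t=1}^{T_i}y^{(i)}_t (y^{(i)}_t)^\top\quad(i=1,\dots,n_u).$$ If $T_0\ge n_x$ and $T_i\ge n_x+1$ for all $i=1,\dots,n_u$, then with probability at least $1-\delta$ the following bounds hold simultaneously: $$(\hat A-A)^\top(\hat A-A)\preceq \sigma_w^2\Bigl(2\sqrt{n_x}+\sqrt{2\log(2/\delta)}\Bigr)^2 M_0^{-1},$$ $$\begin{bmatrix}\hat B_i-B_i & [\hat B_0]_i-[B_0]_i\end{bmatrix}^\top\begin{bmatrix}\hat B_i-B_i & [\hat B_0]_i-[B_0]_i\end{bmatrix}\preceq \sigma_w^2\Bigl(\sqrt{n_x+1}+\sqrt{n_x}+\sqrt{2\log(2n_u/\delta)}\Bigr)^2 M_i^{-1}\quad\text{for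 all } i=1,\dots,n_u.$$ If some $M_i$, $i\in\{0,\dots,n_u\}$, has zero as an eigenvalue, the inverse of that eigenvalue is taken to be $+\infty$: $G\preceq cM^{-1}$ means $v^\top G v\le c\sum_k\lambda_k^{-1}(q_k^\top v)^2$ for all $v$, where $(\lambda_k,q_k)$ are orthonormal eigenpairs of $M$, with $0^{-1}=\infty$ and $\infty\cdot 0=0$. -/

import Mathlib

open MeasureTheory ProbabilityTheory Matrix
open scoped ENNReal Matrix

namespace BilinearID

noncomputable section

/-- One step of the bilinear system
`x⁺ = A x + B₀ u + ∑ᵢ [u]ᵢ (Bᵢ - A) x + w`. -/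
def step {nx nu : ℕ} (A : Matrix (Fin nx) (Fin nx) ℝ) (B₀ : Matrix (Fin nx) (Fin nu) ℝ)
    (B : Fin nu → Matrix (Fin nx) (Fin nx) ℝ)
    (x : EuclideanSpace ℝ (Fin nx)) (u : EuclideanSpace ℝ (Fin nu))
    (w : EuclideanSpace ℝ (Fin nx)) : EuclideanSpace ℝ (Fin nx) :=
  WithLp.toLp 2 (A *ᵥ x.ofLp + B₀ *ᵥ u.ofLp + ∑ i, u i • ((B i - A) *ᵥ x.ofLp)) + w

/-- The constant input of experiment `i ∈ {0, …, nu}`: `u⁰ = 0` and `uⁱ = eᵢ` for `i ≥ 1`. -/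
def input {nu : ℕ} (i : Fin (nu + 1)) : EuclideanSpace ℝ (Fin nu) :=
  Fin.cases 0 (fun j => EuclideanSpace.single j 1) i

/-- The affine regressor `y = [xᵀ 1]ᵀ`. -/
def affineRegressor {nx : ℕ} (x : EuclideanSpace ℝ (Fin nx)) : Fin nx ⊕ Unit → ℝ :=
  Sum.elim x.ofLp (fun _ => 1)

/-- The block matrix `[B  b]` with last column `b`. -/
def appendCol {nx : ℕ} (B : Matrix (Fin nx) (Fin nx) ℝ) (b : Fin nx → ℝ) :
    Matrix (Fin nx) (Fin nx ⊕ Unit) ℝ :=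
  Matrix.fromCols B (Matrix.replicateCol Unit b)

/-- `Θ` is an ordinary least squares estimate for the regressors `y` and the targets `z`:
it minimizes `∑ₜ ‖zₜ - Θ yₜ‖₂²` over all matrices. -/
def IsOLS {nx N : ℕ} {ι : Type*} [Fintype ι] (y : Fin N → ι → ℝ)
    (z : Fin N → EuclideanSpace ℝ (Fin nx)) (Θ : Matrix (Fin nx) ι ℝ) : Prop :=
  IsMinOn (fun Θ' : Matrix (Fin nx) ι ℝ => ∑ t, ‖z t - WithLp.toLp 2 (Θ' *ᵥ y t)‖ ^ 2)
    Set.univ Θ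

/-- The data matrix `∑ₜ yₜ yₜᵀ`. -/
def gram {N : ℕ} {ι : Type*} (y : Fin N → ι → ℝ) : Matrix ι ι ℝ :=
  ∑ t, Matrix.vecMulVec (y t) (y t)

theorem gram_posSemidef {N : ℕ} {ι : Type*} [Fintype ι] (y : Fin N → ι → ℝ) :
    (gram y).PosSemidef :=
  Matrix.posSemidef_sum _ fun t _ => by
    simpa using Matrix.posSemidef_vecMulVec_self_star (y t)

/-- The quadratic form `v ↦ vᵀ M⁻¹ v = ∑ₖ λₖ⁻¹ ⟨qₖ, v⟩²` of the inverse of a positive semidefinite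
matrix `M` with eigenpairs `(λₖ, qₖ)`, where the inverse of a zero eigenvalue is `∞`
(in `ℝ≥0∞`, `0⁻¹ = ∞` and `∞ * 0 = 0`). -/
def invQuadForm {ι : Type*} [Fintype ι] [DecidableEq ι] {M : Matrix ι ι ℝ} (hM : M.PosSemidef)
    (v : EuclideanSpace ℝ ι) : ℝ≥0∞ :=
  ∑ k, (ENNReal.ofReal (hM.isHermitian.eigenvalues k))⁻¹ *
    ENNReal.ofReal (inner ℝ (hM.isHermitian.eigenvectorBasis k) v ^ 2)

/-- The ellipsoidal bound `G ⪯ c M⁻¹` in the Loewner order, `M` positive semidefinite and possibly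
singular: `vᵀ G v ≤ c · vᵀ M⁻¹ v` for all `v`. -/
def LeScaledInv {ι : Type*} [Fintype ι] [DecidableEq ι] (G : Matrix ι ι ℝ) (c : ℝ)
    {M : Matrix ι ι ℝ} (hM : M.PosSemidef) : Prop :=
  ∀ v : EuclideanSpace ℝ ι,
    ENNReal.ofReal (v.ofLp ⬝ᵥ G *ᵥ v.ofLp) ≤ ENNReal.ofReal c * invQuadForm hM v

end

end BilinearID

/-! The proof separates a deterministic part from a probabilistic one. The normal equations say that
the estimation error `D` satisfies `D M u = ∑ (yₜ·u) wₜ` for every `u`. If this sum has norm at most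
`C √(uᵀ M u)` for all `u`, then writing `v = M u` gives `vᵀ Dᵀ D v ≤ C² vᵀ M⁻¹ v`; a `v` outside the
range of `M` makes the right side infinite (`IsOLS.leScaledInv`).

For the noise, freeze the regressors by independence and Fubini. The vectors `(yₜ·u)ₜ` fill a
subspace of dimension at most the number of regressor entries, so `C` has to dominate the operator
norm of a Gaussian matrix restricted to that subspace: `σ (√nx + √dim + s)` fails with probability
at most `exp (-s²/2)` (`measure_exists_norm_sum_smul_gt_le`).

This sharp tail is obtained without Gaussian concentration. Slepian comparison is applied to `(∑ exp
(κ t Xᵢ)) ^ (1/κ)`, a smooth substitute for `exp (t max Xᵢ)`, with `Xᵢ = ⟪vᵢ, W uᵢ⟫`. Adding an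
independent common Gaussian to `X` matches its variances with those of `⟪vᵢ, g⟫ + ⟪uᵢ, h⟫`, whose
maximum is at most `‖g‖ + ‖h‖`. The norms have sub-Gaussian moment generating functions, Markov's
inequality gives the tail, and `κ → ∞` removes the number of variables. A union bound over the
experiments concludes. -/

namespace BilinearID

/-! ### Standard Gaussian measure: density, Stein's identity, moments of the norm -/

section StdGaussian

open Real Module Filter Topology
open scoped RealInnerProductSpace

/-- The density of the standard Gaussian measure with respect to the volume. -/
noncomputable def stdGaussianDensity (E : Type*) [NormedAddCommGroup E] [InnerProductSpace ℝ E]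
    (x : E) : ℝ :=
  ((2 * π) ^ (finrank ℝ E / 2 : ℝ))⁻¹ * exp (-(1 / 2) * ‖x‖ ^ 2)

lemma stdGaussianDensity_pos {E : Type*} [NormedAddCommGroup E]
    [InnerProductSpace ℝ E] (x : E) : 0 < stdGaussianDensity E x := by
  unfold stdGaussianDensity; positivity

lemma continuous_stdGaussianDensity {E : Type*} [NormedAddCommGroup E]
    [InnerProductSpace ℝ E] : Continuous (stdGaussianDensity E) := by
  unfold stdGaussianDensity; fun_prop

lemma hasFDerivAt_stdGaussianDensity {E : Type*} [NormedAddCommGroup E]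
    [InnerProductSpace ℝ E] (x : E) :
    HasFDerivAt (stdGaussianDensity E) (-(stdGaussianDensity E x) • innerSL ℝ x) x := by
  have h : HasFDerivAt (fun x : E => -(1 / 2) * ‖x‖ ^ 2)
      ((-(1 / 2) : ℝ) • (2 • innerSL ℝ x)) x :=
    (hasStrictFDerivAt_norm_sq x).hasFDerivAt.const_mul (-(1 / 2) : ℝ)
  refine (h.exp.const_mul (((2 * π) ^ (finrank ℝ E / 2 : ℝ))⁻¹)).congr_fderiv ?_
  rw [stdGaussianDensity]
  ext y
  simp
  ring

variable {E : Type*} [NormedAddCommGroup E] [InnerProductSpace ℝ E] [FiniteDimensional ℝ E]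
  [MeasurableSpace E] [BorelSpace E]
  {F : Type*} [NormedAddCommGroup F] [InnerProductSpace ℝ F] [FiniteDimensional ℝ F]
  [MeasurableSpace F] [BorelSpace F]

lemma integrable_exp_neg_mul_sq_norm {b : ℝ} (hb : 0 < b) :
    Integrable (fun x : E => exp (-b * ‖x‖ ^ 2)) := by
  have h := (GaussianFourier.integrable_cexp_neg_mul_sq_norm_add (V := E) (b := (b : ℂ))
    (by simpa using hb) 0 0).norm
  refine h.congr (Eventually.of_forall fun x => ?_)
  simp [Complex.norm_exp, ← Complex.ofReal_pow]

lemma integrable_stdGaussianDensity : Integrable (stdGaussianDensity E) :=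
  (integrable_exp_neg_mul_sq_norm (E := E) (b := 1 / 2) (by norm_num)).const_mul _

/-- Both measures have the same characteristic function. The density turns Gaussian integrals into
Lebesgue ones, where integration by parts is available. -/
lemma stdGaussian_eq_withDensity :
    stdGaussian E = volume.withDensity (fun x => ENNReal.ofReal (stdGaussianDensity E x)) := by
  have : IsFiniteMeasure (volume.withDensity
      (fun x : E => ENNReal.ofReal (stdGaussianDensity E x))) :=
    isFiniteMeasure_withDensity_ofReal integrable_stdGaussianDensity.2
  refine Measure.ext_of_charFun ?_
  ext t
  have hm : Measurable (fun x : E => ENNReal.ofReal (stdGaussianDensity E x)) :=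
    continuous_stdGaussianDensity.measurable.ennreal_ofReal
  rw [charFun_stdGaussian, charFun_apply,
    integral_withDensity_eq_integral_toReal_smul hm (by simp)]
  have h := GaussianFourier.integral_cexp_neg_mul_sq_norm_add (V := E) (b := 1 / 2)
    (by norm_num) Complex.I t
  have h2 : ∀ x : E, (ENNReal.ofReal (stdGaussianDensity E x)).toReal •
      Complex.exp (⟪x, t⟫ * Complex.I) = (((2 * π) ^ (finrank ℝ E / 2 : ℝ))⁻¹ : ℝ) *
        Complex.exp (-(1 / 2) * ‖x‖ ^ 2 + Complex.I * ⟪t, x⟫) := by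
    intro x
    rw [ENNReal.toReal_ofReal (stdGaussianDensity_pos x).le, stdGaussianDensity,
      Complex.real_smul, Complex.exp_add, real_inner_comm]
    push_cast
    ring_nf
  simp_rw [h2]
  rw [integral_const_mul, h]
  have h3 : ((π : ℂ) / (1 / 2)) ^ ((finrank ℝ E : ℂ) / 2) =
      (((2 * π) ^ (finrank ℝ E / 2 : ℝ) : ℝ) : ℂ) := by
    rw [Complex.ofReal_cpow (by positivity)]
    push_cast
    congr 1
    ring
  rw [h3, ← mul_assoc, ← Complex.ofReal_mul, inv_mul_cancel₀ (by positivity)]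
  simp only [Complex.ofReal_one, one_mul, Complex.I_sq]
  congr 1
  ring

lemma integral_stdGaussian_eq {G : Type*} [NormedAddCommGroup G] [NormedSpace ℝ G] (f : E → G) :
    ∫ x, f x ∂stdGaussian E = ∫ x, stdGaussianDensity E x • f x := by
  rw [stdGaussian_eq_withDensity, integral_withDensity_eq_integral_toReal_smul
    continuous_stdGaussianDensity.measurable.ennreal_ofReal (by simp)]
  simp_rw [ENNReal.toReal_ofReal (stdGaussianDensity_pos _).le]

lemma integrable_stdGaussian_iff {G : Type*} [NormedAddCommGroup G] [NormedSpace ℝ G] {f : E → G} :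
    Integrable f (stdGaussian E) ↔ Integrable (fun x => stdGaussianDensity E x • f x) := by
  rw [stdGaussian_eq_withDensity, integrable_withDensity_iff_integrable_smul'
    continuous_stdGaussianDensity.measurable.ennreal_ofReal (by simp)]
  simp_rw [ENNReal.toReal_ofReal (stdGaussianDensity_pos _).le]

/-- **Gaussian integration by parts** (Stein's identity). -/
theorem integral_inner_mul_stdGaussian {f f' : E → ℝ} {c : E}
    (hf : ∀ x, HasLineDerivAt ℝ f (f' x) x c) (hfi : Integrable f (stdGaussian E))
    (hf' : Integrable f' (stdGaussian E))
    (hcf : Integrable (fun x => ⟪c, x⟫ * f x) (stdGaussian E)) :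
    ∫ x, ⟪c, x⟫ * f x ∂stdGaussian E = ∫ x, f' x ∂stdGaussian E := by
  rw [integrable_stdGaussian_iff] at hfi hf' hcf
  rw [integral_stdGaussian_eq, integral_stdGaussian_eq]
  have h := integral_bilinear_hasLineDerivAt_right_eq_neg_left_of_integrable (μ := volume)
    (f := stdGaussianDensity E) (f' := fun x => -(stdGaussianDensity E x) * ⟪c, x⟫)
    (g := f) (g' := f') (v := c) (B := ContinuousLinearMap.mul ℝ ℝ)
    (by simpa [mul_assoc] using hcf.neg) (by simpa using hf') (by simpa using hfi)
    (fun x _ => by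
      simpa [real_inner_comm] using (hasFDerivAt_stdGaussianDensity x).hasLineDerivAt c)
    (fun x _ => hf x)
  simp only [ContinuousLinearMap.mul_apply', smul_eq_mul] at h ⊢
  rw [h, ← integral_neg]
  congr with x
  ring

lemma integrable_exp_mul_sq_norm_stdGaussian {s : ℝ} (hs : s < 1) :
    Integrable (fun x : E => exp (s / 2 * ‖x‖ ^ 2)) (stdGaussian E) := by
  rw [integrable_stdGaussian_iff]
  refine ((integrable_exp_neg_mul_sq_norm (E := E) (b := (1 - s) / 2)
    (by linarith)).const_mul (((2 * π) ^ (finrank ℝ E / 2 : ℝ))⁻¹)).congr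
      (Eventually.of_forall fun x => ?_)
  simp only [stdGaussianDensity, smul_eq_mul, mul_assoc, ← Real.exp_add]
  congr 2
  ring

lemma integral_exp_mul_sq_norm_stdGaussian {s : ℝ} (hs : s < 1) :
    ∫ x : E, exp (s / 2 * ‖x‖ ^ 2) ∂stdGaussian E = ((1 - s) ^ (finrank ℝ E / 2 : ℝ))⁻¹ := by
  rw [integral_stdGaussian_eq]
  have h : ∀ x : E, stdGaussianDensity E x • exp (s / 2 * ‖x‖ ^ 2) =
      ((2 * π) ^ (finrank ℝ E / 2 : ℝ))⁻¹ * exp (-((1 - s) / 2) * ‖x‖ ^ 2) := by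
    intro x
    simp only [stdGaussianDensity, smul_eq_mul, mul_assoc, ← Real.exp_add]
    congr 2
    ring
  have hs' : 0 < 1 - s := by linarith
  simp_rw [h]
  rw [integral_const_mul, GaussianFourier.integral_rexp_neg_mul_sq_norm (by linarith),
    show π / ((1 - s) / 2) = (2 * π) / (1 - s) by field_simp,
    Real.div_rpow (by positivity) hs'.le]
  field_simp

/-- Completing the square. It bounds the exponential moment of the norm by that of its square, which
is explicit. -/
lemma exp_mul_le_exp_mul_sq {s : ℝ} (hs : 0 < s) (l r : ℝ) :
    exp (l * r) ≤ exp (l ^ 2 / (2 * s)) * exp (s / 2 * r ^ 2) := by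
  rw [← Real.exp_add, Real.exp_le_exp]
  have : l ^ 2 / (2 * s) + s / 2 * r ^ 2 - l * r = (l - s * r) ^ 2 / (2 * s) := by
    field_simp; ring
  have h2 : 0 ≤ (l - s * r) ^ 2 / (2 * s) := by positivity
  linarith

lemma integrable_exp_mul_norm_stdGaussian (l : ℝ) :
    Integrable (fun x : E => exp (l * ‖x‖)) (stdGaussian E) := by
  refine ((integrable_exp_mul_sq_norm_stdGaussian (E := E) (s := 1 / 2) (by norm_num)).const_mul
    (exp (l ^ 2 / (2 * (1 / 2))))).mono' (by fun_prop) (Eventually.of_forall fun x => ?_)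
  rw [Real.norm_of_nonneg (by positivity)]
  exact exp_mul_le_exp_mul_sq (by norm_num) _ _

/-- Sub-Gaussian bound for the moment generating function of the norm of a standard Gaussian
vector, centered at the square root of the dimension. -/
theorem integral_exp_mul_norm_stdGaussian_le [Nontrivial E] {l : ℝ} (hl : 0 < l) :
    ∫ x : E, exp (l * ‖x‖) ∂stdGaussian E ≤ exp (l * √(finrank ℝ E) + l ^ 2 / 2) := by
  set n := finrank ℝ E with hn
  have hn0 : 0 < (n : ℝ) := by exact_mod_cast finrank_pos (R := ℝ) (M := E)
  set q := √(n : ℝ) with hq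
  have hq0 : 0 < q := Real.sqrt_pos.2 hn0
  have hqn : (n : ℝ) = q ^ 2 := (Real.sq_sqrt hn0.le).symm
  -- Chosen so that `(1 - s)⁻¹ = 1 + l / q`; after `1 + x ≤ exp x` the two exponents `l (q + l) / 2`
  -- and `l q / 2` add up to `l q + l² / 2`.
  set s := l / (q + l) with hs
  have hs0 : 0 < s := by positivity
  have h1s : 1 - s = (1 + l / q)⁻¹ := by rw [hs]; field_simp; ring
  have hs1 : s < 1 := by
    have : 0 < 1 - s := by rw [h1s]; positivity
    linarith
  calc ∫ x : E, exp (l * ‖x‖) ∂stdGaussian E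
      ≤ ∫ x : E, exp (l ^ 2 / (2 * s)) * exp (s / 2 * ‖x‖ ^ 2) ∂stdGaussian E :=
        integral_mono (integrable_exp_mul_norm_stdGaussian l)
          ((integrable_exp_mul_sq_norm_stdGaussian hs1).const_mul _)
          fun x => exp_mul_le_exp_mul_sq hs0 _ _
    _ = exp (l ^ 2 / (2 * s)) * (1 + l / q) ^ (n / 2 : ℝ) := by
        rw [integral_const_mul, integral_exp_mul_sq_norm_stdGaussian hs1, h1s,
          Real.inv_rpow (by positivity), inv_inv]
    _ ≤ exp (l ^ 2 / (2 * s)) * exp (l / q) ^ (n / 2 : ℝ) := by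
        gcongr
        linarith [Real.add_one_le_exp (l / q)]
    _ = exp (l * q + l ^ 2 / 2) := by
        rw [← Real.exp_mul, ← Real.exp_add, hqn, hs]
        congr 1
        field_simp
        ring

lemma map_toLp_prod_stdGaussian :
    ((stdGaussian E).prod (stdGaussian F)).map (WithLp.toLp 2) =
      stdGaussian (WithLp 2 (E × F)) := by
  refine Measure.ext_of_charFun ?_
  ext t
  rw [charFun_prod, charFun_stdGaussian, charFun_stdGaussian, charFun_stdGaussian,
    ← Complex.exp_add, ← Complex.ofReal_pow, ← Complex.ofReal_pow, ← Complex.ofReal_pow,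
    WithLp.prod_norm_sq_eq_of_L2]
  congr 1
  push_cast
  simp
  ring

lemma integral_stdGaussian_prod_mul (f : E → ℝ) (g : F → ℝ) :
    ∫ x, f x.fst * g x.snd ∂stdGaussian (WithLp 2 (E × F)) =
      (∫ x, f x ∂stdGaussian E) * ∫ x, g x ∂stdGaussian F := by
  rw [← map_toLp_prod_stdGaussian, ← MeasurableEquiv.coe_toLp, integral_map_equiv]
  simpa using integral_prod_mul f g

lemma integrable_stdGaussian_prod_mul {f : E → ℝ} {g : F → ℝ} (hf : Integrable f (stdGaussian E))
    (hg : Integrable g (stdGaussian F)) :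
    Integrable (fun x => f x.fst * g x.snd) (stdGaussian (WithLp 2 (E × F))) := by
  rw [← map_toLp_prod_stdGaussian, ← MeasurableEquiv.coe_toLp, integrable_map_equiv]
  exact hf.mul_prod hg

end StdGaussian

/-! ### Slepian comparison for powers of sums of exponentials -/

section Slepian

open Real Module Filter Topology
open scoped RealInnerProductSpace

/-- The sum of the exponentials of the linear forms with coefficient vectors `c i`. -/
noncomputable def sumExp {ι E : Type*} [Fintype ι] [NormedAddCommGroup E] [InnerProductSpace ℝ E]
    (c : ι → E) (x : E) : ℝ :=
  ∑ i, exp ⟪c i, x⟫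

lemma norm_mul_exp_le (R r : ℝ) : r * exp (R * r) ≤ exp ((R + 1) * r) := by
  have h : r ≤ exp r := by linarith [Real.add_one_le_exp r]
  calc r * exp (R * r) ≤ exp r * exp (R * r) := by gcongr
    _ = _ := by rw [← Real.exp_add]; ring_nf

lemma abs_inner_mul_le {E : Type*} [NormedAddCommGroup E] [InnerProductSpace ℝ E]
    {c : E} {R K r : ℝ} (hc : ‖c‖ ≤ R) (hK : 0 ≤ K) (hR : 0 ≤ R) {x : E}
    (hr : |r| ≤ K * exp (R * ‖x‖)) : |⟪c, x⟫ * r| ≤ R * K * exp ((R + 1) * ‖x‖) := by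
  rw [abs_mul]
  calc |⟪c, x⟫| * |r| ≤ (R * ‖x‖) * (K * exp (R * ‖x‖)) := by
        gcongr
        exact (abs_real_inner_le_norm _ _).trans (by gcongr)
    _ = R * K * (‖x‖ * exp (R * ‖x‖)) := by ring
    _ ≤ _ := by gcongr; exact norm_mul_exp_le _ _

section Bounds

variable {ι E : Type*} [Fintype ι] [NormedAddCommGroup E] [InnerProductSpace ℝ E]

lemma exp_inner_le_sumExp (c : ι → E) (x : E) (i : ι) : exp ⟪c i, x⟫ ≤ sumExp c x :=
  Finset.single_le_sum (f := fun i => exp ⟪c i, x⟫) (fun _ _ => (exp_pos _).le)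
    (Finset.mem_univ i)

lemma sumExp_pos [Nonempty ι] (c : ι → E) (x : E) : 0 < sumExp c x :=
  Finset.sum_pos (fun _ _ => exp_pos _) Finset.univ_nonempty

lemma sumExp_le {c : ι → E} {R : ℝ} (hc : ∀ i, ‖c i‖ ≤ R) (x : E) :
    sumExp c x ≤ Fintype.card ι * exp (R * ‖x‖) := by
  calc sumExp c x ≤ ∑ _i : ι, exp (R * ‖x‖) := by
        refine Finset.sum_le_sum fun i _ => Real.exp_le_exp.2 ((real_inner_le_norm _ _).trans ?_)
        gcongr
        exact hc i
    _ = _ := by simp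

lemma sumExp_rpow_le [Nonempty ι] {c : ι → E} {R : ℝ} (hR : 0 ≤ R) (hc : ∀ i, ‖c i‖ ≤ R)
    {p : ℝ} (hp0 : 0 ≤ p) (hp1 : p ≤ 1) (x : E) :
    sumExp c x ^ p ≤ (1 + Fintype.card ι) * exp (R * ‖x‖) := by
  have h1 : 1 ≤ exp (R * ‖x‖) := Real.one_le_exp (by positivity)
  have h2 := sumExp_le hc x
  have h0 := sumExp_pos c x
  have h3 : sumExp c x ^ p ≤ 1 + sumExp c x := by
    rcases le_total (sumExp c x) 1 with h | h
    · linarith [Real.rpow_le_one h0.le h hp0]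
    · have := Real.rpow_le_rpow_of_exponent_le h hp1
      rw [Real.rpow_one] at this
      linarith
  linarith

/-- Each exponential is one summand of `sumExp`. Hence derivatives of the power are controlled by
the power itself, which yields the dominations needed below. -/
lemma sumExp_rpow_sub_one_mul_le [Nonempty ι] (c : ι → E) (p : ℝ) (x : E) (i : ι) :
    sumExp c x ^ (p - 1) * exp ⟪c i, x⟫ ≤ sumExp c x ^ p := by
  have h0 := sumExp_pos c x
  calc sumExp c x ^ (p - 1) * exp ⟪c i, x⟫ ≤ sumExp c x ^ (p - 1) * sumExp c x := by
        gcongr; exact exp_inner_le_sumExp c x i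
    _ = sumExp c x ^ p := by rw [← Real.rpow_add_one h0.ne']; ring_nf

lemma continuous_sumExp (c : ι → E) : Continuous (sumExp c) := by
  unfold sumExp; fun_prop

lemma continuous_sumExp_rpow [Nonempty ι] (c : ι → E) (p : ℝ) :
    Continuous (fun x => sumExp c x ^ p) :=
  (continuous_sumExp c).rpow_const fun x => Or.inl (sumExp_pos c x).ne'

lemma abs_sum_exp_mul_le (c : ι → E) (x : E) {d : ι → ℝ} {K : ℝ} (hd : ∀ i, |d i| ≤ K) :
    |∑ i, exp ⟪c i, x⟫ * d i| ≤ sumExp c x * K := by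
  refine (Finset.abs_sum_le_sum_abs _ _).trans ?_
  rw [sumExp, Finset.sum_mul]
  refine Finset.sum_le_sum fun i _ => ?_
  rw [abs_mul, abs_of_pos (exp_pos _)]
  gcongr
  exact hd i

end Bounds

variable {E : Type*} [NormedAddCommGroup E] [InnerProductSpace ℝ E] [FiniteDimensional ℝ E]
  [MeasurableSpace E] [BorelSpace E] {ι : Type*} [Fintype ι] [Nonempty ι]

lemma integrable_of_le_exp_norm {f : E → ℝ} (hf : Continuous f) {K R : ℝ}
    (h : ∀ x, |f x| ≤ K * exp (R * ‖x‖)) : Integrable f (stdGaussian E) :=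
  ((integrable_exp_mul_norm_stdGaussian R).const_mul K).mono' hf.aestronglyMeasurable
    (Eventually.of_forall h)

lemma integrable_sumExp_rpow (c : ι → E) {p : ℝ} (hp0 : 0 ≤ p) (hp1 : p ≤ 1) :
    Integrable (fun x => sumExp c x ^ p) (stdGaussian E) := by
  refine integrable_of_le_exp_norm (continuous_sumExp_rpow c p) (K := 1 + Fintype.card ι)
    (R := ∑ i, ‖c i‖) fun x => ?_
  rw [abs_of_nonneg (Real.rpow_nonneg (sumExp_pos c x).le _)]
  exact sumExp_rpow_le (by positivity)
    (fun i => Finset.single_le_sum (f := fun i => ‖c i‖) (fun _ _ => norm_nonneg _)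
      (Finset.mem_univ i)) hp0 hp1 x

lemma integrable_inner_mul_sumExp_rpow (c : ι → E) (c' : E) {p : ℝ} (hp0 : 0 ≤ p) (hp1 : p ≤ 1)
    (i : ι) :
    Integrable (fun x => ⟪c', x⟫ * (sumExp c x ^ (p - 1) * exp ⟪c i, x⟫)) (stdGaussian E) := by
  have hR : 0 ≤ ‖c'‖ + ∑ i, ‖c i‖ := by positivity
  have hc : ∀ i, ‖c i‖ ≤ ‖c'‖ + ∑ i, ‖c i‖ := fun i =>
    (Finset.single_le_sum (f := fun i => ‖c i‖) (fun _ _ => norm_nonneg _)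
      (Finset.mem_univ i)).trans (by simp)
  refine integrable_of_le_exp_norm
    (K := (‖c'‖ + ∑ i, ‖c i‖) * (1 + Fintype.card ι)) (R := ‖c'‖ + ∑ i, ‖c i‖ + 1)
    (by have := continuous_sumExp_rpow c (p - 1); fun_prop) fun x => ?_
  refine abs_inner_mul_le (K := 1 + Fintype.card ι) (R := ‖c'‖ + ∑ i, ‖c i‖)
    (le_add_of_nonneg_right (by positivity)) (by positivity) hR ?_
  have := sumExp_pos c x
  rw [abs_of_nonneg (by positivity)]
  exact (sumExp_rpow_sub_one_mul_le c p x i).trans (sumExp_rpow_le hR hc hp0 hp1 x)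

/-- Stein's identity for the product `sumExp c x ^ (p - 1) * exp ⟪c i, x⟫`, differentiated in the
direction `c'`. -/
lemma integral_inner_mul_sumExp_rpow (c : ι → E) (c' : E) {p : ℝ} (hp0 : 0 ≤ p) (hp1 : p ≤ 1)
    (i : ι) :
    ∫ x, ⟪c', x⟫ * (sumExp c x ^ (p - 1) * exp ⟪c i, x⟫) ∂stdGaussian E =
      ∫ x, (p - 1) * (sumExp c x ^ (p - 2) * (∑ j, exp ⟪c j, x⟫ * ⟪c j, c'⟫) * exp ⟪c i, x⟫) +
        sumExp c x ^ (p - 1) * exp ⟪c i, x⟫ * ⟪c i, c'⟫ ∂stdGaussian E := by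
  have hS : ∀ x, 0 < sumExp c x := sumExp_pos c
  have hcont := continuous_sumExp_rpow c (p - 1)
  have hcont2 := continuous_sumExp_rpow c (p - 2)
  have hint := integrable_sumExp_rpow c hp0 hp1
  have hi : Integrable (fun x => sumExp c x ^ (p - 1) * exp ⟪c i, x⟫) (stdGaussian E) := by
    refine hint.mono' (by fun_prop) (Eventually.of_forall fun x => ?_)
    have := hS x
    rw [Real.norm_of_nonneg (by positivity)]
    exact sumExp_rpow_sub_one_mul_le c p x i
  refine integral_inner_mul_stdGaussian (fun x => ?_) hi ?_
    (integrable_inner_mul_sumExp_rpow c c' hp0 hp1 i)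
  · have he : ∀ j, HasFDerivAt (fun x => exp ⟪c j, x⟫) (exp ⟪c j, x⟫ • innerSL ℝ (c j)) x :=
      fun j => (innerSL ℝ (c j)).hasFDerivAt.exp
    have h1 : HasFDerivAt (sumExp c) (∑ j, exp ⟪c j, x⟫ • innerSL ℝ (c j)) x :=
      HasFDerivAt.fun_sum fun j _ => he j
    have h2 := (h1.rpow_const (p := p - 1) (Or.inl (hS x).ne')).mul (he i)
    convert! h2.hasLineDerivAt c' using 1
    simp only [_root_.add_apply, _root_.smul_apply, smul_eq_mul,
      _root_.sum_apply, innerSL_apply_apply]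
    rw [show p - 1 - 1 = p - 2 by ring]
    ring
  · refine (Integrable.const_mul ?_ _).add (hi.mul_const _)
    set K := ∑ j, |⟪c j, c'⟫| with hK
    have hd : ∀ j, |⟪c j, c'⟫| ≤ K := fun j =>
      Finset.single_le_sum (f := fun j => |⟪c j, c'⟫|) (fun _ _ => abs_nonneg _)
        (Finset.mem_univ j)
    refine (hint.const_mul K).mono' (by fun_prop) (Eventually.of_forall fun x => ?_)
    have h0 := hS x
    rw [Real.norm_eq_abs, abs_mul, abs_mul, abs_of_pos (exp_pos _),
      abs_of_pos (Real.rpow_pos_of_pos h0 _)]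
    calc sumExp c x ^ (p - 2) * |∑ j, exp ⟪c j, x⟫ * ⟪c j, c'⟫| * exp ⟪c i, x⟫
        ≤ sumExp c x ^ (p - 2) * (sumExp c x * K) * exp ⟪c i, x⟫ := by
          gcongr
          exact abs_sum_exp_mul_le c x hd
      _ = K * (sumExp c x ^ (p - 2 + 1) * exp ⟪c i, x⟫) := by
          rw [Real.rpow_add_one h0.ne']; ring
      _ ≤ K * sumExp c x ^ p := by
          rw [show p - 2 + 1 = p - 1 by ring]
          have : 0 ≤ K := by positivity
          gcongr
          exact sumExp_rpow_sub_one_mul_le c p x i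

/-- **Slepian's comparison inequality** for a power `p ∈ [0, 1]` of a sum of exponentials of
Gaussian variables: decreasing the covariances at fixed variances increases the expectation. The two
Gaussian families are taken independent of each other. -/
theorem integral_sumExp_rpow_le_of_orthogonal {a b : ι → E} (hab : ∀ i j, ⟪a i, b j⟫ = 0)
    (hnorm : ∀ i, ‖a i‖ = ‖b i‖) (hle : ∀ i j, ⟪b i, b j⟫ ≤ ⟪a i, a j⟫)
    {p : ℝ} (hp0 : 0 ≤ p) (hp1 : p ≤ 1) :
    ∫ x, sumExp a x ^ p ∂stdGaussian E ≤ ∫ x, sumExp b x ^ p ∂stdGaussian E := by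
  -- Rotate from `a` to `b`; `c'` is the derivative in `θ`. The expectation is shown to increase
  -- along this path.
  set c : ℝ → ι → E := fun θ i => cos θ • a i + sin θ • b i with hc
  set c' : ℝ → ι → E := fun θ i => -sin θ • a i + cos θ • b i with hc'
  set R : ℝ := ∑ i, (‖a i‖ + ‖b i‖) with hR
  have hR0 : 0 ≤ R := by positivity
  have hRi : ∀ i, ‖a i‖ + ‖b i‖ ≤ R := fun i =>
    Finset.single_le_sum (f := fun i => ‖a i‖ + ‖b i‖) (fun _ _ => by positivity)
      (Finset.mem_univ i)
  have hcR : ∀ θ i, ‖c θ i‖ ≤ R := fun θ i => by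
    refine ((norm_add_le _ _).trans ?_).trans (hRi i)
    rw [norm_smul, norm_smul, Real.norm_eq_abs, Real.norm_eq_abs]
    gcongr
    · exact mul_le_of_le_one_left (norm_nonneg _) (abs_cos_le_one θ)
    · exact mul_le_of_le_one_left (norm_nonneg _) (abs_sin_le_one θ)
  have hcR' : ∀ θ i, ‖c' θ i‖ ≤ R := fun θ i => by
    refine ((norm_add_le _ _).trans ?_).trans (hRi i)
    rw [norm_smul, norm_smul, Real.norm_eq_abs, Real.norm_eq_abs, abs_neg]
    gcongr
    · exact mul_le_of_le_one_left (norm_nonneg _) (abs_sin_le_one θ)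
    · exact mul_le_of_le_one_left (norm_nonneg _) (abs_cos_le_one θ)
  have hcc : ∀ θ j i, ⟪c θ j, c' θ i⟫ = sin θ * cos θ * (⟪b j, b i⟫ - ⟪a j, a i⟫) := by
    intro θ j i
    simp only [hc, hc', inner_add_left, inner_add_right, inner_smul_left, inner_smul_right, hab,
      real_inner_comm (b j) (a i) ▸ hab i j]
    simp
    ring
  set G : ℝ → E → ℝ := fun θ x =>
    ∑ i, p * (⟪c' θ i, x⟫ * (sumExp (c θ) x ^ (p - 1) * exp ⟪c θ i, x⟫)) with hG
  have hder : ∀ θ x, HasDerivAt (fun θ => sumExp (c θ) x ^ p) (G θ x) θ := by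
    intro θ x
    have h1 : ∀ i, HasDerivAt (fun θ => ⟪c θ i, x⟫) ⟪c' θ i, x⟫ θ := fun i => by
      have := ((hasDerivAt_cos θ).mul_const ⟪a i, x⟫).add
        ((hasDerivAt_sin θ).mul_const ⟪b i, x⟫)
      simpa [hc, hc', inner_add_left, inner_smul_left] using! this
    have h2 : HasDerivAt (fun θ => sumExp (c θ) x) (∑ i, exp ⟪c θ i, x⟫ * ⟪c' θ i, x⟫) θ :=
      HasDerivAt.fun_sum fun i _ => (h1 i).exp
    convert! h2.rpow_const (p := p) (Or.inl (sumExp_pos _ x).ne') using 1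
    rw [hG, Finset.sum_mul, Finset.sum_mul]
    exact Finset.sum_congr rfl fun i _ => by ring
  have hterm : ∀ θ x i, |⟪c' θ i, x⟫ * (sumExp (c θ) x ^ (p - 1) * exp ⟪c θ i, x⟫)| ≤
      R * (1 + Fintype.card ι) * exp ((R + 1) * ‖x‖) := by
    intro θ x i
    refine abs_inner_mul_le (hcR' θ i) (by positivity) hR0 ?_
    have := sumExp_pos (c θ) x
    rw [abs_of_nonneg (by positivity)]
    exact (sumExp_rpow_sub_one_mul_le _ p x i).trans (sumExp_rpow_le hR0 (hcR θ) hp0 hp1 x)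
  have hFder : ∀ θ, HasDerivAt (fun θ => ∫ x, sumExp (c θ) x ^ p ∂stdGaussian E)
      (∫ x, G θ x ∂stdGaussian E) θ := by
    intro θ
    refine (hasDerivAt_integral_of_dominated_loc_of_deriv_le (F := fun θ x => sumExp (c θ) x ^ p)
      (F' := G) (s := Set.univ)
      (bound := fun x => ∑ _i : ι, p * (R * (1 + Fintype.card ι) * exp ((R + 1) * ‖x‖)))
      Filter.univ_mem
      (Eventually.of_forall fun θ => (continuous_sumExp_rpow (c θ) p).aestronglyMeasurable)
      (integrable_sumExp_rpow (c θ) hp0 hp1) ?_ ?_ ?_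
      (Eventually.of_forall fun x θ _ => hder θ x)).2
    · have := continuous_sumExp_rpow (c θ) (p - 1)
      exact Continuous.aestronglyMeasurable (by fun_prop)
    · refine Eventually.of_forall fun x θ _ => (norm_sum_le _ _).trans
        (Finset.sum_le_sum fun i _ => ?_)
      rw [norm_mul, Real.norm_of_nonneg hp0]
      gcongr
      exact hterm θ x i
    · exact integrable_finsetSum _ fun i _ =>
        ((integrable_exp_mul_norm_stdGaussian (R + 1)).const_mul _).const_mul _
  have hmono : MonotoneOn (fun θ => ∫ x, sumExp (c θ) x ^ p ∂stdGaussian E)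
      (Set.Icc 0 (π / 2)) := by
    refine monotoneOn_of_deriv_nonneg (convex_Icc _ _)
      (fun θ _ => (hFder θ).continuousAt.continuousWithinAt)
      (fun θ _ => (hFder θ).differentiableAt.differentiableWithinAt) fun θ hθ => ?_
    rw [interior_Icc] at hθ
    have hsc : 0 ≤ sin θ * cos θ := mul_nonneg
      (sin_nonneg_of_nonneg_of_le_pi hθ.1.le (by linarith [hθ.2, pi_pos]))
      (cos_nonneg_of_neg_pi_div_two_le_of_le (by linarith [hθ.1, pi_pos]) hθ.2.le)
    rw [(hFder θ).deriv, hG, integral_finsetSum _ fun i _ =>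
      (integrable_inner_mul_sumExp_rpow (c θ) (c' θ i) hp0 hp1 i).const_mul p]
    refine Finset.sum_nonneg fun i _ => ?_
    rw [integral_const_mul, integral_inner_mul_sumExp_rpow (c θ) (c' θ i) hp0 hp1 i]
    refine mul_nonneg hp0 (integral_nonneg fun x => ?_)
    have h0 := sumExp_pos (c θ) x
    -- Equal norms kill the diagonal term. What remains is `p - 1 ≤ 0` times a sum that is
    -- nonpositive by the covariance comparison.
    have hii : ⟪c θ i, c' θ i⟫ = 0 := by
      rw [hcc, real_inner_self_eq_norm_sq, real_inner_self_eq_norm_sq, hnorm, sub_self, mul_zero]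
    have hsum : ∑ j, exp ⟪c θ j, x⟫ * ⟪c θ j, c' θ i⟫ ≤ 0 :=
      Finset.sum_nonpos fun j _ => mul_nonpos_of_nonneg_of_nonpos (exp_pos _).le
        (by rw [hcc]; exact mul_nonpos_of_nonneg_of_nonpos hsc (by linarith [hle j i]))
    simp only [hii, mul_zero, add_zero, Pi.zero_apply]
    refine mul_nonneg_of_nonpos_of_nonpos (by linarith)
      (mul_nonpos_of_nonpos_of_nonneg (mul_nonpos_of_nonneg_of_nonpos ?_ hsum) (exp_pos _).le)
    positivity
  have := hmono (Set.left_mem_Icc.2 (by positivity)) (Set.right_mem_Icc.2 (by positivity))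
    (by positivity : (0 : ℝ) ≤ π / 2)
  simpa [hc] using this

end Slepian

/-! ### Tails of Gaussian bilinear forms and of Gaussian operators -/

section Chevet

open Real Module Filter Topology
open scoped RealInnerProductSpace

variable {E : Type*} [NormedAddCommGroup E] [InnerProductSpace ℝ E] [FiniteDimensional ℝ E]
  [MeasurableSpace E] [BorelSpace E]
  {F : Type*} [NormedAddCommGroup F] [InnerProductSpace ℝ F] [FiniteDimensional ℝ F]
  [MeasurableSpace F] [BorelSpace F]
  {H : Type*} [NormedAddCommGroup H] [InnerProductSpace ℝ H] [FiniteDimensional ℝ H]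
  [MeasurableSpace H] [BorelSpace H]

lemma stdGaussian_real : stdGaussian ℝ = gaussianReal 0 1 := by
  refine Measure.ext_of_charFun ?_
  ext t
  rw [charFun_stdGaussian, charFun_gaussianReal, ← Complex.ofReal_pow, Real.norm_eq_abs, sq_abs]
  congr 1
  simp
  ring

lemma integral_exp_mul_stdGaussian_real (l : ℝ) :
    ∫ y : ℝ, exp (l * y) ∂stdGaussian ℝ = exp (l ^ 2 / 2) := by
  rw [stdGaussian_real]
  simpa [mgf] using congrFun (mgf_id_gaussianReal (μ := 0) (v := 1)) l

lemma integral_stdGaussian_fst (f : E → ℝ) :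
    ∫ x, f x.fst ∂stdGaussian (WithLp 2 (E × F)) = ∫ x, f x ∂stdGaussian E := by
  simpa using integral_stdGaussian_prod_mul (F := F) f 1

lemma integral_stdGaussian_snd (f : F → ℝ) :
    ∫ x, f x.snd ∂stdGaussian (WithLp 2 (E × F)) = ∫ x, f x ∂stdGaussian F := by
  simpa using integral_stdGaussian_prod_mul (E := E) 1 f

/-- **Slepian's comparison inequality** for a power of a sum of exponentials, where the first
family is augmented by an independent common Gaussian variable of variance `ρ ^ 2`. -/
theorem exp_mul_integral_sumExp_rpow_le {ι : Type*} [Fintype ι] [Nonempty ι] {a : ι → E}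
    {b : ι → F} {ρ : ℝ} (hnorm : ∀ i, ‖a i‖ ^ 2 + ρ ^ 2 = ‖b i‖ ^ 2)
    (hle : ∀ i j, ⟪b i, b j⟫ ≤ ⟪a i, a j⟫ + ρ ^ 2) {p : ℝ} (hp0 : 0 ≤ p) (hp1 : p ≤ 1) :
    exp ((p * ρ) ^ 2 / 2) * ∫ x, sumExp a x ^ p ∂stdGaussian E ≤
      ∫ x, sumExp b x ^ p ∂stdGaussian F := by
  -- The common Gaussian is an extra coordinate with coefficient `ρ`; it factors out of the sum and
  -- contributes its moment generating function at `p * ρ`. Separate blocks make the families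
  -- orthogonal.
  have h := integral_sumExp_rpow_le_of_orthogonal (E := WithLp 2 (WithLp 2 (E × ℝ) × F))
    (a := fun i => WithLp.toLp 2 (WithLp.toLp 2 (a i, ρ), 0))
    (b := fun i => WithLp.toLp 2 (0, b i)) (fun i j => by simp) (fun i => ?_) (fun i j => ?_)
    hp0 hp1
  · have h1 : ∀ x : WithLp 2 (WithLp 2 (E × ℝ) × F),
        sumExp (fun i => WithLp.toLp 2 (WithLp.toLp 2 (a i, ρ), (0 : F))) x ^ p =
          (fun y : WithLp 2 (E × ℝ) =>
            (fun z => sumExp a z ^ p) y.fst * (fun s => exp (p * ρ * s)) y.snd) x.fst := by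
      intro x
      have h2 : sumExp (fun i => WithLp.toLp 2 (WithLp.toLp 2 (a i, ρ), (0 : F))) x =
          sumExp a x.fst.fst * exp (ρ * x.fst.snd) := by
        simp only [sumExp, Finset.sum_mul, ← Real.exp_add]
        refine Finset.sum_congr rfl fun i _ => ?_
        simp [mul_comm]
      rw [h2, Real.mul_rpow (sumExp_pos _ _).le (exp_pos _).le, ← Real.exp_mul]
      ring_nf
    have h3 : ∀ x : WithLp 2 (WithLp 2 (E × ℝ) × F),
        sumExp (fun i => WithLp.toLp 2 ((0 : WithLp 2 (E × ℝ)), b i)) x ^ p =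
          (fun y => sumExp b y ^ p) x.snd := by
      intro x
      simp [sumExp]
    simp_rw [h1, h3] at h
    rw [integral_stdGaussian_snd (fun y => sumExp b y ^ p), integral_stdGaussian_fst
      (fun y : WithLp 2 (E × ℝ) =>
            (fun z => sumExp a z ^ p) y.fst * (fun s => exp (p * ρ * s)) y.snd),
      integral_stdGaussian_prod_mul (fun z => sumExp a z ^ p) (fun s : ℝ => exp (p * ρ * s)),
      integral_exp_mul_stdGaussian_real, mul_comm] at h
    exact h
  · rw [← sq_eq_sq₀ (norm_nonneg _) (norm_nonneg _)]
    simp [WithLp.prod_norm_sq_eq_of_L2, hnorm]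
  · simpa [pow_two] using hle i j

/-- Tail bound for finitely many Gaussian variables whose covariances are the products of the inner
products of two families of unit vectors. -/
theorem measureReal_exists_inner_gt_le {ι : Type*} [Fintype ι] [Nontrivial F] [Nontrivial H]
    {a : ι → E} {v : ι → F} {u : ι → H} (hv : ∀ i, ‖v i‖ = 1) (hu : ∀ i, ‖u i‖ = 1)
    (ha : ∀ i j, ⟪a i, a j⟫ = ⟪v i, v j⟫ * ⟪u i, u j⟫) {t : ℝ} (ht : 0 < t) :
    (stdGaussian E).real {x | ∃ i, √(finrank ℝ F) + √(finrank ℝ H) + t < ⟪a i, x⟫} ≤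
      exp (-t ^ 2 / 2) := by
  rcases isEmpty_or_nonempty ι with hι | hι
  · simp [exp_nonneg]
  set C := √(finrank ℝ F : ℝ) + √(finrank ℝ H : ℝ) + t with hC
  have hN : (0 : ℝ) < Fintype.card ι := by exact_mod_cast Fintype.card_pos
  -- With `κ = k + 1` the power `1 / κ` stays in `[0, 1]`, and replacing the maximum by the smooth
  -- sum costs only the factor `N ^ (1 / κ)`, `N` being the number of variables.
  have key : ∀ k : ℕ, (stdGaussian E).real {x | ∃ i, C < ⟪a i, x⟫} ≤
      (Fintype.card ι : ℝ) ^ (1 / ((k : ℝ) + 1)) * exp (-t ^ 2 / 2) := by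
    intro k
    set κ : ℝ := (k : ℝ) + 1 with hκ
    have hκ0 : 0 < κ := by positivity
    have hκ1 : 1 ≤ κ := by simp [hκ]
    have hp0 : 0 ≤ 1 / κ := by positivity
    have hp1 : 1 / κ ≤ 1 := by rw [div_le_one hκ0]; exact hκ1
    have ha1 : ∀ i, ‖a i‖ ^ 2 = 1 := fun i => by
      rw [← real_inner_self_eq_norm_sq, ha, real_inner_self_eq_norm_sq,
        real_inner_self_eq_norm_sq, hv, hu]
      norm_num
    have hcs : ∀ i j, ⟪v i, v j⟫ ≤ 1 ∧ ⟪u i, u j⟫ ≤ 1 := fun i j =>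
      ⟨(real_inner_le_norm _ _).trans (by simp [hv]), (real_inner_le_norm _ _).trans (by simp [hu])⟩
    have hsl := exp_mul_integral_sumExp_rpow_le (a := fun i => (κ * t) • a i)
      (b := fun i => (κ * t) • WithLp.toLp 2 (v i, u i)) (ρ := κ * t)
      (fun i => by
        rw [norm_smul, norm_smul, mul_pow, mul_pow ‖κ * t‖ ‖WithLp.toLp 2 _‖, ha1,
          WithLp.prod_norm_sq_eq_of_L2]
        rw [Real.norm_eq_abs, sq_abs]
        simp [hv, hu]
        ring)
      (fun i j => by
        simp only [real_inner_smul_left, real_inner_smul_right, ha]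
        rw [WithLp.prod_inner_apply]
        dsimp only
        -- The covariance comparison is `(1 - ⟪v i, v j⟫) (1 - ⟪u i, u j⟫) ≥ 0`.
        have h1 := mul_nonneg (sub_nonneg.2 (hcs i j).1) (sub_nonneg.2 (hcs i j).2)
        have h2 := mul_nonneg (sq_nonneg (κ * t)) h1
        nlinarith [h2]) hp0 hp1
    have hρ : 1 / κ * (κ * t) = t := by field_simp
    rw [hρ] at hsl
    have hmarkov := mul_meas_ge_le_integral_of_nonneg (μ := stdGaussian E)
      (f := fun x => sumExp (fun i => (κ * t) • a i) x ^ (1 / κ))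
      (Eventually.of_forall fun x => Real.rpow_nonneg (sumExp_pos _ _).le _)
      (integrable_sumExp_rpow _ hp0 hp1) (exp (t * C))
    have hsub : (stdGaussian E).real {x | ∃ i, C < ⟪a i, x⟫} ≤ (stdGaussian E).real
        {x | exp (t * C) ≤ sumExp (fun i => (κ * t) • a i) x ^ (1 / κ)} := by
      refine measureReal_mono fun x ⟨i, hi⟩ => ?_
      have h1 := Real.rpow_le_rpow (exp_pos _).le
        (exp_inner_le_sumExp (fun i => (κ * t) • a i) x i) hp0
      refine le_trans ?_ h1
      rw [← Real.exp_mul, Real.exp_le_exp, real_inner_smul_left]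
      have : κ * t * ⟪a i, x⟫ * (1 / κ) = t * ⟪a i, x⟫ := by field_simp
      rw [this]
      gcongr
    have hright : ∫ x, sumExp (fun i => (κ * t) • WithLp.toLp 2 (v i, u i)) x ^ (1 / κ)
        ∂stdGaussian (WithLp 2 (F × H)) ≤ (Fintype.card ι : ℝ) ^ (1 / κ) *
          (exp (t * √(finrank ℝ F) + t ^ 2 / 2) * exp (t * √(finrank ℝ H) + t ^ 2 / 2)) := by
      calc _ ≤ ∫ x : WithLp 2 (F × H), (Fintype.card ι : ℝ) ^ (1 / κ) *
              (exp (t * ‖x.fst‖) * exp (t * ‖x.snd‖)) ∂stdGaussian (WithLp 2 (F × H)) := by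
            refine integral_mono (integrable_sumExp_rpow _ hp0 hp1)
              (((integrable_stdGaussian_prod_mul (integrable_exp_mul_norm_stdGaussian t)
                (integrable_exp_mul_norm_stdGaussian t))).const_mul _) fun x => ?_
            have h1 : sumExp (fun i => (κ * t) • WithLp.toLp 2 (v i, u i)) x ≤
                Fintype.card ι * exp (κ * (t * ‖x.fst‖ + t * ‖x.snd‖)) := by
              calc _ ≤ ∑ _i : ι, exp (κ * (t * ‖x.fst‖ + t * ‖x.snd‖)) := by
                    refine Finset.sum_le_sum fun i _ => Real.exp_le_exp.2 ?_
                    rw [real_inner_smul_left, WithLp.prod_inner_apply, mul_assoc, ← mul_add]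
                    have h1 := real_inner_le_norm (v i) x.fst
                    have h2 := real_inner_le_norm (u i) x.snd
                    rw [hv, one_mul] at h1
                    rw [hu, one_mul] at h2
                    gcongr
                    · exact h1
                    · exact h2
                _ = _ := by simp
            refine (Real.rpow_le_rpow (sumExp_pos _ _).le h1 hp0).trans_eq ?_
            rw [Real.mul_rpow hN.le (exp_pos _).le, ← Real.exp_mul, ← Real.exp_add]
            congr 2
            field_simp
        _ = (Fintype.card ι : ℝ) ^ (1 / κ) * ((∫ x : F, exp (t * ‖x‖) ∂stdGaussian F) *
              ∫ x : H, exp (t * ‖x‖) ∂stdGaussian H) := by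
            rw [integral_const_mul]
            congr 1
            exact integral_stdGaussian_prod_mul (fun x : F => exp (t * ‖x‖))
              (fun x : H => exp (t * ‖x‖))
        _ ≤ _ := by
            gcongr
            · exact integral_exp_mul_norm_stdGaussian_le ht
            · exact integral_exp_mul_norm_stdGaussian_le ht
    have hall : exp (t ^ 2 / 2) * (exp (t * C) *
        (stdGaussian E).real {x | ∃ i, C < ⟪a i, x⟫}) ≤ (Fintype.card ι : ℝ) ^ (1 / κ) *
          (exp (t * √(finrank ℝ F) + t ^ 2 / 2) * exp (t * √(finrank ℝ H) + t ^ 2 / 2)) := by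
      refine (mul_le_mul_of_nonneg_left ?_ (exp_pos _).le).trans (hsl.trans hright)
      exact (mul_le_mul_of_nonneg_left hsub (exp_pos _).le).trans hmarkov
    rw [← mul_assoc, ← Real.exp_add, ← Real.exp_add] at hall
    -- The two norms cost `t²` and the threshold gains `t²`; the decay `-t² / 2` is exactly the
    -- contribution of the common Gaussian.
    have hexp : exp (t * √(finrank ℝ F) + t ^ 2 / 2 + (t * √(finrank ℝ H) + t ^ 2 / 2)) =
        exp (t ^ 2 / 2 + t * C) * exp (-t ^ 2 / 2) := by
      rw [← Real.exp_add, hC]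
      congr 1
      ring
    rw [hexp] at hall
    refine le_of_mul_le_mul_left (hall.trans_eq ?_) (exp_pos (t ^ 2 / 2 + t * C))
    ring
  have hlim : Tendsto (fun k : ℕ => (Fintype.card ι : ℝ) ^ (1 / ((k : ℝ) + 1)) *
      exp (-t ^ 2 / 2)) atTop (𝓝 ((Fintype.card ι : ℝ) ^ (0 : ℝ) * exp (-t ^ 2 / 2))) :=
    (((continuous_const_rpow hN.ne').tendsto 0).comp
      tendsto_one_div_add_atTop_nhds_zero_nat).mul_const _
  rw [Real.rpow_zero, one_mul] at hlim
  exact ge_of_tendsto' hlim key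

/-- Tail bound for a sequence of Gaussian variables whose covariances are the products of the inner
products of two sequences of unit vectors. -/
theorem measure_exists_inner_gt_le [Nontrivial F] [Nontrivial H]
    {a : ℕ → E} {v : ℕ → F} {u : ℕ → H} (hv : ∀ i, ‖v i‖ = 1) (hu : ∀ i, ‖u i‖ = 1)
    (ha : ∀ i j, ⟪a i, a j⟫ = ⟪v i, v j⟫ * ⟪u i, u j⟫) {t : ℝ} (ht : 0 < t) :
    stdGaussian E {x | ∃ i, √(finrank ℝ F) + √(finrank ℝ H) + t < ⟪a i, x⟫} ≤
      ENNReal.ofReal (exp (-t ^ 2 / 2)) := by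
  set C := √(finrank ℝ F : ℝ) + √(finrank ℝ H : ℝ) + t with hC
  have hU : {x | ∃ i, C < ⟪a i, x⟫} = ⋃ n : ℕ, {x | ∃ i : Fin n, C < ⟪a i, x⟫} := by
    ext x
    simp only [Set.mem_ofPred_eq, Set.mem_iUnion]
    exact ⟨fun ⟨i, hi⟩ => ⟨i + 1, ⟨i, i.lt_succ_self⟩, hi⟩, fun ⟨_, i, hi⟩ => ⟨i, hi⟩⟩
  have hmono : Monotone fun n : ℕ => {x | ∃ i : Fin n, C < ⟪a i, x⟫} :=
    fun m n hmn x ⟨i, hi⟩ => ⟨Fin.castLE hmn i, hi⟩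
  rw [hU, hmono.measure_iUnion]
  refine iSup_le fun n => ?_
  rw [← ofReal_measureReal]
  exact ENNReal.ofReal_le_ofReal (measureReal_exists_inner_gt_le (ι := Fin n) (fun i => hv i)
    (fun i => hu i) (fun i j => ha i j) ht)

/-- **Davidson–Szarek bound**: with probability at least `1 - exp (-t² / 2)`, the restriction of a
standard Gaussian operator from `ℝ^τ` to `H` to a subspace `K` has operator norm at most
`√(dim H) + √(dim K) + t`. -/
theorem measure_exists_norm_sum_smul_gt_le {τ : Type*} [Fintype τ]
    (K : Submodule ℝ (EuclideanSpace ℝ τ)) {t : ℝ} (ht : 0 < t) :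
    stdGaussian (PiLp 2 fun _ : τ => H)
      {W | ∃ u ∈ K, (√(finrank ℝ H) + √(finrank ℝ K) + t) * ‖u‖ < ‖∑ s, u s • W s‖} ≤
      ENNReal.ofReal (exp (-t ^ 2 / 2)) := by
  set C := √(finrank ℝ H : ℝ) + √(finrank ℝ K : ℝ) + t with hC
  have hC0 : 0 ≤ C := by positivity
  -- The rank-one tensor `v ⊗ u`: pairing it with `W` gives `⟪v, W u⟫`, and inner products of such
  -- tensors factor.
  let a : H → K → PiLp 2 (fun _ : τ => H) := fun v u => WithLp.toLp 2 fun s => u.1 s • v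
  have hainner : ∀ v u W, ⟪a v u, W⟫ = ⟪v, ∑ s, u.1 s • W s⟫ := fun v u W => by
    simp [a, PiLp.inner_apply, inner_sum, real_inner_smul_left, real_inner_smul_right]
  have haa : ∀ v u v' u', ⟪a v u, a v' u'⟫ = ⟪v, v'⟫ * ⟪u, u'⟫ := fun v u v' u' => by
    rw [hainner]
    simp only [a, ← Finset.sum_smul, smul_smul, real_inner_smul_right, Submodule.coe_inner,
      PiLp.inner_apply]
    rw [mul_comm]
    simp [mul_comm]
  have hex : ∀ W : PiLp 2 (fun _ : τ => H), (∃ u ∈ K, C * ‖u‖ < ‖∑ s, u s • W s‖) →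
      ∃ q : Metric.sphere (0 : H) 1 × Metric.sphere (0 : K) 1, C < ⟪a q.1 q.2, W⟫ := by
    rintro W ⟨u, hu, hlt⟩
    have hs : 0 < ‖∑ s, u s • W s‖ := lt_of_le_of_lt (by positivity) hlt
    have hu0 : 0 < ‖u‖ := by
      rw [norm_pos_iff]
      rintro rfl
      simp at hs
    set S := ∑ s, u s • W s with hS
    refine ⟨(⟨‖S‖⁻¹ • S, ?_⟩, ⟨‖u‖⁻¹ • ⟨u, hu⟩, ?_⟩), ?_⟩
    · simp [norm_smul, hs.ne']
    · simp [norm_smul, hu0.ne']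
    · rw [hainner]
      have h1 : ∑ s, (‖u‖⁻¹ • (⟨u, hu⟩ : K)).1 s • W s = ‖u‖⁻¹ • S := by
        simp [hS, Finset.smul_sum, smul_smul]
      rw [h1, real_inner_smul_left, real_inner_smul_right, real_inner_self_eq_norm_sq]
      have h2 : ‖S‖⁻¹ * (‖u‖⁻¹ * ‖S‖ ^ 2) = ‖S‖ / ‖u‖ := by field_simp
      rw [h2, lt_div_iff₀ hu0]
      exact hlt
  by_cases hne : Nonempty (Metric.sphere (0 : H) 1 × Metric.sphere (0 : K) 1)
  -- Exceeding `C` is an open condition on the pair of unit vectors, so a dense sequence detects it.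
  · let d := TopologicalSpace.denseSeq (Metric.sphere (0 : H) 1 × Metric.sphere (0 : K) 1)
    have hd : DenseRange d := TopologicalSpace.denseRange_denseSeq _
    have hv : ∀ n, ‖((d n).1 : H)‖ = 1 := fun n => mem_sphere_zero_iff_norm.1 (d n).1.2
    have hu : ∀ n, ‖((d n).2 : K)‖ = 1 := fun n => mem_sphere_zero_iff_norm.1 (d n).2.2
    have : Nontrivial H := nontrivial_of_ne ((d 0).1 : H) 0 fun h => by
      have := hv 0; rw [h] at this; simp at this
    have : Nontrivial K := nontrivial_of_ne ((d 0).2 : K) 0 fun h => by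
      have := hu 0; rw [h] at this; simp at this
    refine (measure_mono fun W hW => ?_).trans (measure_exists_inner_gt_le
      (a := fun n => a (d n).1 (d n).2) (v := fun n => ((d n).1 : H)) (u := fun n => ((d n).2 : K))
      hv hu (fun i j => haa _ _ _ _) ht)
    have hopen : IsOpen {q : Metric.sphere (0 : H) 1 × Metric.sphere (0 : K) 1 |
        C < ⟪a q.1 q.2, W⟫} := by
      refine isOpen_lt continuous_const ?_
      simp_rw [hainner]
      fun_prop
    obtain ⟨n, hn⟩ := hd.exists_mem_open hopen (hex W hW)
    exact ⟨n, hn⟩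
  · have : {W : PiLp 2 (fun _ : τ => H) | ∃ u ∈ K, C * ‖u‖ < ‖∑ s, u s • W s‖} = ∅ :=
      Set.eq_empty_of_forall_notMem fun W hW => hne ⟨(hex W hW).choose⟩
    rw [this]
    simp

end Chevet

/-! ### Deterministic least squares: normal equations and the ellipsoid -/

section LeastSquares

open scoped RealInnerProductSpace

variable {nx N : ℕ} {ι : Type*} [Fintype ι]

lemma gram_mulVec (y : Fin N → ι → ℝ) (u : ι → ℝ) :
    gram y *ᵥ u = ∑ t, (y t ⬝ᵥ u) • y t := by
  simp [gram, Matrix.sum_mulVec, Matrix.vecMulVec_mulVec]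

lemma dotProduct_gram_mulVec (y : Fin N → ι → ℝ) (u : ι → ℝ) :
    u ⬝ᵥ gram y *ᵥ u = ‖WithLp.toLp 2 fun t => y t ⬝ᵥ u‖ ^ 2 := by
  rw [gram_mulVec, dotProduct_sum, EuclideanSpace.real_norm_sq_eq]
  refine Finset.sum_congr rfl fun t _ => ?_
  rw [dotProduct_smul, dotProduct_comm u, smul_eq_mul]
  ring

/-- The normal equations: the residuals of a least squares estimate are orthogonal to the
regressors. -/
lemma IsOLS.sum_dotProduct_smul_residual {y : Fin N → ι → ℝ}
    {z : Fin N → EuclideanSpace ℝ (Fin nx)} {Θ : Matrix (Fin nx) ι ℝ} (h : IsOLS y z Θ)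
    (u : ι → ℝ) : ∑ t, (y t ⬝ᵥ u) • (z t - WithLp.toLp 2 (Θ *ᵥ y t)) = 0 := by
  set r : Fin N → EuclideanSpace ℝ (Fin nx) := fun t => z t - WithLp.toLp 2 (Θ *ᵥ y t) with hr
  set S := ∑ t, (y t ⬝ᵥ u) • r t with hS
  set Q := ∑ t, (y t ⬝ᵥ u) ^ 2 with hQ
  have hQ0 : 0 ≤ Q := Finset.sum_nonneg fun _ _ => sq_nonneg _
  -- Step size for perturbing `Θ` along `S uᵀ`: `ε * Q ≤ 1` lets the linear decrease beat the
  -- quadratic term, and the `+ 1` covers `Q = 0`.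
  set ε : ℝ := (Q + 1)⁻¹ with hε
  have h1 : ∑ t, ‖r t‖ ^ 2 ≤ ∑ t, ‖r t - (ε * (y t ⬝ᵥ u)) • S‖ ^ 2 := by
    refine (h (Set.mem_univ (Θ + ε • Matrix.vecMulVec S.ofLp u))).trans_eq ?_
    refine Finset.sum_congr rfl fun t _ => ?_
    congr 2
    rw [hr, sub_sub]
    congr 1
    ext i
    simp [Matrix.add_mulVec, Matrix.smul_mulVec, Matrix.vecMulVec_mulVec, dotProduct_comm u]
    ring
  have h2 : ∑ t, ‖r t - (ε * (y t ⬝ᵥ u)) • S‖ ^ 2 =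
      ∑ t, ‖r t‖ ^ 2 - 2 * ε * ‖S‖ ^ 2 + ε ^ 2 * Q * ‖S‖ ^ 2 := by
    have h3 : ‖S‖ ^ 2 = ∑ t, (y t ⬝ᵥ u) * ⟪r t, S⟫ := by
      rw [← real_inner_self_eq_norm_sq]
      nth_rewrite 1 [hS]
      simp [sum_inner, real_inner_smul_left]
    simp_rw [norm_sub_sq_real, real_inner_smul_right, norm_smul, mul_pow, Real.norm_eq_abs, sq_abs]
    rw [Finset.sum_add_distrib, Finset.sum_sub_distrib]
    congr 1
    · rw [h3, Finset.mul_sum]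
      congr 1
      exact Finset.sum_congr rfl fun t _ => by ring
    · rw [hQ, Finset.mul_sum, Finset.sum_mul]
      exact Finset.sum_congr rfl fun t _ => by ring
  have hε0 : 0 < ε := by positivity
  have hεQ : ε * Q ≤ 1 := by
    rw [hε, inv_mul_le_iff₀ (by positivity)]
    linarith
  have h4 : ε * ‖S‖ ^ 2 ≤ 0 := by
    have : ε * Q * (ε * ‖S‖ ^ 2) ≤ 1 * (ε * ‖S‖ ^ 2) := by gcongr
    nlinarith
  have h5 : ‖S‖ ^ 2 ≤ 0 := nonpos_of_mul_nonpos_right h4 hε0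
  simpa using le_antisymm h5 (sq_nonneg _)

/-- If `v` has a component in the kernel of `M`, the right side is infinite; otherwise `v = M u` and
`vᵀ M⁻¹ v = uᵀ M u`. -/
lemma leScaledInv_of_norm_mulVec_le [DecidableEq ι] {M : Matrix ι ι ℝ} (hM : M.PosSemidef)
    {D : Matrix (Fin nx) ι ℝ} {c : ℝ} (hc : 0 < c)
    (h : ∀ u, ‖WithLp.toLp 2 (D *ᵥ (M *ᵥ u))‖ ^ 2 ≤ c * (u ⬝ᵥ M *ᵥ u)) :
    LeScaledInv (Dᵀ * D) c hM := by
  intro v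
  set q := hM.isHermitian.eigenvectorBasis with hq
  set l := hM.isHermitian.eigenvalues with hl
  have hl0 : ∀ k, 0 ≤ l k := hM.eigenvalues_nonneg
  by_cases hker : ∃ k, l k = 0 ∧ ⟪q k, v⟫ ≠ 0
  · obtain ⟨k, hk, hkv⟩ := hker
    have htop : invQuadForm hM v = ⊤ := by
      refine ENNReal.sum_eq_top.2 ⟨k, Finset.mem_univ k, ?_⟩
      rw [← hl, ← hq, hk, ENNReal.ofReal_zero, ENNReal.inv_zero, ENNReal.top_mul]
      simpa using hkv
    -- Positivity of `c` matters here, since `0 * ∞ = 0`.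
    rw [htop, ENNReal.mul_top (by simpa using hc)]
    exact le_top
  · push Not at hker
    -- The pseudo-inverse applied to `v`; real `0⁻¹ = 0` drops the kernel directions, where `v` has
    -- no component.
    set u : EuclideanSpace ℝ ι := ∑ k, ((l k)⁻¹ * ⟪q k, v⟫) • q k with hu
    have hMu : M *ᵥ u.ofLp = v.ofLp := by
      rw [hu, WithLp.ofLp_sum, Matrix.mulVec_sum]
      conv_rhs => rw [← q.sum_repr' v, WithLp.ofLp_sum]
      refine Finset.sum_congr rfl fun k _ => ?_
      rw [WithLp.ofLp_smul, WithLp.ofLp_smul, Matrix.mulVec_smul, hq,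
        hM.isHermitian.mulVec_eigenvectorBasis, ← hq, ← hl, smul_smul]
      congr 1
      rcases eq_or_ne (l k) 0 with hk | hk
      · simp [hk, hker k hk]
      · field_simp
    have huv : u.ofLp ⬝ᵥ v.ofLp = ∑ k, (l k)⁻¹ * ⟪q k, v⟫ ^ 2 := by
      have : u.ofLp ⬝ᵥ v.ofLp = ⟪u, v⟫ := by
        rw [EuclideanSpace.inner_eq_star_dotProduct, dotProduct_comm]
        simp
      rw [this, hu, sum_inner]
      refine Finset.sum_congr rfl fun k _ => ?_
      rw [real_inner_smul_left]
      ring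
    have hform : invQuadForm hM v = ENNReal.ofReal (u.ofLp ⬝ᵥ v.ofLp) := by
      rw [huv, ENNReal.ofReal_sum_of_nonneg fun k _ => mul_nonneg (inv_nonneg.2 (hl0 k))
        (sq_nonneg _)]
      refine Finset.sum_congr rfl fun k _ => ?_
      rw [ENNReal.ofReal_mul (inv_nonneg.2 (hl0 k)), ← hl, ← hq]
      rcases eq_or_ne (l k) 0 with hk | hk
      · simp [hk, hker k hk]
      · rw [ENNReal.ofReal_inv_of_pos (lt_of_le_of_ne (hl0 k) hk.symm)]
    rw [hform, ← ENNReal.ofReal_mul hc.le]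
    refine ENNReal.ofReal_le_ofReal ?_
    have h1 := h u.ofLp
    rw [hMu] at h1
    refine le_trans (le_of_eq ?_) h1
    rw [← Matrix.mulVec_mulVec, Matrix.dotProduct_mulVec, Matrix.vecMul_transpose,
      EuclideanSpace.real_norm_sq_eq]
    simp [dotProduct, pow_two]

lemma IsOLS.leScaledInv [DecidableEq ι] {y : Fin N → ι → ℝ}
    {z w : Fin N → EuclideanSpace ℝ (Fin nx)} {Θ Θ' : Matrix (Fin nx) ι ℝ} (h : IsOLS y z Θ)
    (hz : ∀ t, z t = WithLp.toLp 2 (Θ' *ᵥ y t) + w t) {C : ℝ} (hC : 0 < C)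
    (hw : ∀ u, ‖∑ t, (y t ⬝ᵥ u) • w t‖ ≤ C * ‖WithLp.toLp 2 fun t => y t ⬝ᵥ u‖) :
    LeScaledInv ((Θ - Θ')ᵀ * (Θ - Θ')) (C ^ 2) (gram_posSemidef y) := by
  refine leScaledInv_of_norm_mulVec_le _ (by positivity) fun u => ?_
  have h1 : WithLp.toLp 2 ((Θ - Θ') *ᵥ (gram y *ᵥ u)) = ∑ t, (y t ⬝ᵥ u) • w t := by
    have h2 := h.sum_dotProduct_smul_residual u
    rw [← sub_eq_zero, ← neg_eq_zero, ← h2, gram_mulVec, Matrix.mulVec_sum, WithLp.toLp_sum,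
      ← Finset.sum_sub_distrib, ← Finset.sum_neg_distrib]
    refine Finset.sum_congr rfl fun t _ => ?_
    rw [hz, Matrix.mulVec_smul, Matrix.sub_mulVec, WithLp.toLp_smul, WithLp.toLp_sub]
    module
  rw [h1, dotProduct_gram_mulVec, ← mul_pow]
  gcongr
  exact hw u

end LeastSquares

/-! ### Gaussian noise against fixed and random regressors -/

section Noise

open Real Module
open scoped RealInnerProductSpace

variable {nx N : ℕ} {ι : Type*} [Fintype ι]

lemma map_toLp_pi_multivariateGaussian (σ : ℝ) :
    (Measure.pi fun _ : Fin N =>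
      multivariateGaussian 0 (σ ^ 2 • (1 : Matrix (Fin nx) (Fin nx) ℝ))).map (WithLp.toLp 2) =
    (stdGaussian (PiLp 2 fun _ : Fin N => EuclideanSpace ℝ (Fin nx))).map (σ • ·) := by
  have hS : (σ ^ 2 • (1 : Matrix (Fin nx) (Fin nx) ℝ)).PosSemidef :=
    Matrix.PosSemidef.one.smul (sq_nonneg σ)
  have : IsProbabilityMeasure ((Measure.pi fun _ : Fin N =>
      multivariateGaussian 0 (σ ^ 2 • (1 : Matrix (Fin nx) (Fin nx) ℝ))).map (WithLp.toLp 2)) :=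
    Measure.isProbabilityMeasure_map (by fun_prop)
  have : IsProbabilityMeasure ((stdGaussian (PiLp 2 fun _ : Fin N =>
      EuclideanSpace ℝ (Fin nx))).map (σ • ·)) :=
    Measure.isProbabilityMeasure_map (by fun_prop)
  refine Measure.ext_of_charFun ?_
  ext W
  rw [charFun_pi, charFun_map_smul, charFun_stdGaussian]
  simp_rw [charFun_multivariateGaussian hS]
  rw [← Complex.exp_sum]
  congr 1
  rw [← Complex.ofReal_pow, norm_smul, mul_pow, PiLp.norm_sq_eq_of_L2, Real.norm_eq_abs, sq_abs]
  have h : ∀ x : EuclideanSpace ℝ (Fin nx),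
      x.ofLp ⬝ᵥ (σ ^ 2 • (1 : Matrix (Fin nx) (Fin nx) ℝ)) *ᵥ x.ofLp = σ ^ 2 * ‖x‖ ^ 2 := by
    intro x
    rw [Matrix.smul_mulVec, Matrix.one_mulVec, dotProduct_smul, EuclideanSpace.real_norm_sq_eq]
    simp [dotProduct, pow_two]
  simp_rw [h]
  push_cast
  simp [Finset.mul_sum, Finset.sum_div, neg_div]

/-- An intersection of closed conditions; this makes the event, with its uncountable quantifier,
measurable. -/
lemma isClosed_forall_norm_sum_le (C : ℝ) :
    IsClosed {p : (Fin N → ι → ℝ) × (Fin N → EuclideanSpace ℝ (Fin nx)) |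
      ∀ u, ‖∑ t, (p.1 t ⬝ᵥ u) • p.2 t‖ ≤ C * ‖WithLp.toLp 2 fun t => p.1 t ⬝ᵥ u‖} := by
  simp only [Set.ofPred_forall]
  refine isClosed_iInter fun u => isClosed_le ?_ ?_
  · simp only [dotProduct]
    fun_prop
  · simp only [dotProduct]
    fun_prop

/-- Deviation bound for the noise correlated with fixed regressors. -/
lemma pi_multivariateGaussian_exists_gt_le {σ : ℝ} (hσ : 0 < σ) {s : ℝ} (hs : 0 < s)
    (y : Fin N → ι → ℝ) :
    (Measure.pi fun _ : Fin N =>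
      multivariateGaussian 0 (σ ^ 2 • (1 : Matrix (Fin nx) (Fin nx) ℝ)))
      {w | ¬ ∀ u, ‖∑ t, (y t ⬝ᵥ u) • w t‖ ≤
        σ * (√nx + √(Fintype.card ι) + s) * ‖WithLp.toLp 2 fun t => y t ⬝ᵥ u‖} ≤
      ENNReal.ofReal (exp (-s ^ 2 / 2)) := by
  set C := √(nx : ℝ) + √(Fintype.card ι : ℝ) + s with hC
  let Y : (ι → ℝ) →ₗ[ℝ] EuclideanSpace ℝ (Fin N) :=
    (WithLp.linearEquiv 2 ℝ (Fin N → ℝ)).symm.toLinearMap ∘ₗ Matrix.mulVecLin (Matrix.of y)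
  have hY : ∀ u, Y u = WithLp.toLp 2 fun t => y t ⬝ᵥ u := fun u => rfl
  -- Only the range of the regressor map matters, so its dimension replaces the sample size in the
  -- bound.
  set K := LinearMap.range Y with hK
  have hKr : (finrank ℝ K : ℝ) ≤ Fintype.card ι := by
    exact_mod_cast (LinearMap.finrank_range_le Y).trans_eq (by simp)
  set A : Set (PiLp 2 fun _ : Fin N => EuclideanSpace ℝ (Fin nx)) :=
    {W | ¬ ∀ u, ‖∑ t, (y t ⬝ᵥ u) • W t‖ ≤ σ * C * ‖Y u‖} with hA
  have hAm : MeasurableSet A := by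
    have hcl : IsClosed {W : PiLp 2 fun _ : Fin N => EuclideanSpace ℝ (Fin nx) |
        ∀ u, ‖∑ t, (y t ⬝ᵥ u) • W t‖ ≤ σ * C * ‖Y u‖} := by
      simp only [Set.ofPred_forall]
      exact isClosed_iInter fun u => isClosed_le (by fun_prop) (by fun_prop)
    exact hcl.measurableSet.compl
  have h1 : {w : Fin N → EuclideanSpace ℝ (Fin nx) | ¬ ∀ u, ‖∑ t, (y t ⬝ᵥ u) • w t‖ ≤
      σ * C * ‖WithLp.toLp 2 fun t => y t ⬝ᵥ u‖} = WithLp.toLp 2 ⁻¹' A := rfl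
  rw [h1, ← Measure.map_apply (by fun_prop) hAm, map_toLp_pi_multivariateGaussian,
    Measure.map_apply (by fun_prop) hAm]
  refine (measure_mono fun W hW => ?_).trans (measure_exists_norm_sum_smul_gt_le K hs)
  simp only [Set.mem_preimage, hA, Set.mem_ofPred_eq, not_forall, not_le] at hW ⊢
  obtain ⟨u, hu⟩ := hW
  refine ⟨Y u, ⟨u, rfl⟩, ?_⟩
  have h2 : ∑ t, (y t ⬝ᵥ u) • (σ • W) t = σ • ∑ t, Y u t • W t := by
    simp [hY, Finset.smul_sum, smul_smul, mul_comm]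
  rw [h2, norm_smul, Real.norm_of_nonneg hσ.le, mul_assoc, mul_lt_mul_iff_right₀ hσ] at hu
  refine lt_of_le_of_lt ?_ hu
  rw [finrank_euclideanSpace_fin, hC]
  gcongr

/-- Deviation bound for the noise correlated with random regressors independent of it. -/
theorem measure_exists_norm_sum_noise_gt_le {Ω : Type*} [MeasurableSpace Ω] {P : Measure Ω}
    [IsProbabilityMeasure P] {σ : ℝ} (hσ : 0 < σ) {s : ℝ} (hs : 0 < s)
    {φ : EuclideanSpace ℝ (Fin nx) → ι → ℝ} (hφ : Measurable φ)
    {x w : Fin N → Ω → EuclideanSpace ℝ (Fin nx)} (hx : ∀ t, AEMeasurable (x t) P)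
    (hindep : iIndepFun (fun t ω => (x t ω, w t ω)) P) (hxw : ∀ t, IndepFun (x t) (w t) P)
    (hw : ∀ t, HasLaw (w t)
      (multivariateGaussian 0 (σ ^ 2 • (1 : Matrix (Fin nx) (Fin nx) ℝ))) P) :
    P {ω | ¬ ∀ u, ‖∑ t, (φ (x t ω) ⬝ᵥ u) • w t ω‖ ≤
        σ * (√nx + √(Fintype.card ι) + s) * ‖WithLp.toLp 2 fun t => φ (x t ω) ⬝ᵥ u‖} ≤
      ENNReal.ofReal (exp (-s ^ 2 / 2)) := by
  set C := σ * (√(nx : ℝ) + √(Fintype.card ι : ℝ) + s) with hC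
  set G := {p : (Fin N → ι → ℝ) × (Fin N → EuclideanSpace ℝ (Fin nx)) |
      ∀ u, ‖∑ t, (p.1 t ⬝ᵥ u) • p.2 t‖ ≤ C * ‖WithLp.toLp 2 fun t => p.1 t ⬝ᵥ u‖} with hG
  have hGm : MeasurableSet G := (isClosed_forall_norm_sum_le C).measurableSet
  have hwm : ∀ t, AEMeasurable (w t) P := fun t => (hw t).aemeasurable
  have hφx : ∀ t, AEMeasurable (fun ω => φ (x t ω)) P := fun t => hφ.comp_aemeasurable (hx t)
  have hpair : ∀ t, AEMeasurable (fun ω => (φ (x t ω), w t ω)) P :=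
    fun t => (hφx t).prodMk (hwm t)
  set e := MeasurableEquiv.arrowProdEquivProdArrow (ι → ℝ) (EuclideanSpace ℝ (Fin nx)) (Fin N)
  -- Independence across samples and within each pair makes the law a product of regressor law and
  -- noise law; Fubini then reduces to fixed regressors.
  have hlaw : P.map (fun ω => e fun t => (φ (x t ω), w t ω)) =
      (Measure.pi fun t => P.map fun ω => φ (x t ω)).prod (Measure.pi fun _ : Fin N =>
        multivariateGaussian 0 (σ ^ 2 • (1 : Matrix (Fin nx) (Fin nx) ℝ))) := by
    have : ∀ t, IsProbabilityMeasure (P.map fun ω => φ (x t ω)) :=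
      fun t => Measure.isProbabilityMeasure_map (hφx t)
    have h1 : iIndepFun (fun t ω => (φ (x t ω), w t ω)) P :=
      hindep.comp (fun _ p => (φ p.1, p.2)) fun _ => by fun_prop
    have h2 := (iIndepFun_iff_map_fun_eq_pi_map hpair).1 h1
    have h3 : ∀ t, P.map (fun ω => (φ (x t ω), w t ω)) = (P.map fun ω => φ (x t ω)).prod
        (multivariateGaussian 0 (σ ^ 2 • (1 : Matrix (Fin nx) (Fin nx) ℝ))) := fun t => by
      rw [← (hw t).map_eq]
      exact (indepFun_iff_map_prod_eq_prod_map_map (hφx t) (hwm t)).1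
        ((hxw t).comp hφ measurable_id)
    simp_rw [h3] at h2
    rw [← (measurePreserving_arrowProdEquivProdArrow (ι → ℝ) (EuclideanSpace ℝ (Fin nx)) (Fin N)
      (fun t => P.map fun ω => φ (x t ω)) (fun _ =>
        multivariateGaussian 0 (σ ^ 2 • (1 : Matrix (Fin nx) (Fin nx) ℝ)))).map_eq, ← h2,
      AEMeasurable.map_map_of_aemeasurable e.measurable.aemeasurable
        (aemeasurable_pi_lambda _ hpair)]
    rfl
  have hset : {ω | ¬ ∀ u, ‖∑ t, (φ (x t ω) ⬝ᵥ u) • w t ω‖ ≤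
      C * ‖WithLp.toLp 2 fun t => φ (x t ω) ⬝ᵥ u‖} =
      (fun ω => e fun t => (φ (x t ω), w t ω)) ⁻¹' Gᶜ := rfl
  have : ∀ t, IsProbabilityMeasure (P.map fun ω => φ (x t ω)) :=
    fun t => Measure.isProbabilityMeasure_map (hφx t)
  have hem : AEMeasurable (fun ω => e fun t => (φ (x t ω), w t ω)) P :=
    e.measurable.comp_aemeasurable (aemeasurable_pi_lambda _ hpair)
  rw [hset, ← Measure.map_apply_of_aemeasurable hem hGm.compl, hlaw, Measure.prod_apply hGm.compl]
  calc _ ≤ ∫⁻ _y, ENNReal.ofReal (exp (-s ^ 2 / 2))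
        ∂(Measure.pi fun t => P.map fun ω => φ (x t ω)) :=
        lintegral_mono fun y => pi_multivariateGaussian_exists_gt_le hσ hs y
    _ = _ := by simp

end Noise

/-! ### The experiments as linear regressions, and the union bound -/

lemma step_zero {nx nu : ℕ} (A : Matrix (Fin nx) (Fin nx) ℝ) (B₀ : Matrix (Fin nx) (Fin nu) ℝ)
    (B : Fin nu → Matrix (Fin nx) (Fin nx) ℝ) (x w : EuclideanSpace ℝ (Fin nx)) :
    step A B₀ B x (input 0) w = WithLp.toLp 2 (A *ᵥ x.ofLp) + w := by
  simp [step, input]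

lemma step_succ {nx nu : ℕ} (A : Matrix (Fin nx) (Fin nx) ℝ) (B₀ : Matrix (Fin nx) (Fin nu) ℝ)
    (B : Fin nu → Matrix (Fin nx) (Fin nx) ℝ) (i : Fin nu) (x w : EuclideanSpace ℝ (Fin nx)) :
    step A B₀ B x (input i.succ) w =
      WithLp.toLp 2 (appendCol (B i) (B₀.col i) *ᵥ affineRegressor x) + w := by
  have h : ∑ j, (Pi.single i (1 : ℝ) : Fin nu → ℝ) j • ((B j - A) *ᵥ x.ofLp) =
      (B i - A) *ᵥ x.ofLp := by
    simp [Pi.single_apply, ite_smul]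
  have h2 : Matrix.replicateCol Unit (B₀.col i) *ᵥ (fun _ => (1 : ℝ)) = B₀.col i := by
    ext j
    simp [Matrix.mulVec, dotProduct]
  simp only [step, input, Fin.cases_succ, appendCol, affineRegressor,
    Matrix.fromCols_mulVec_sumElim, h2, PiLp.ofLp_single, Matrix.mulVec_single_one]
  rw [h, Matrix.sub_mulVec]
  congr 2
  abel

lemma appendCol_sub {nx : ℕ} (B B' : Matrix (Fin nx) (Fin nx) ℝ) (b b' : Fin nx → ℝ) :
    appendCol (B - B') (b - b') = appendCol B b - appendCol B' b' := by
  ext i j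
  rcases j with j | j <;> simp [appendCol]

lemma measurable_affineRegressor {nx : ℕ} : Measurable (affineRegressor (nx := nx)) := by
  refine measurable_pi_iff.2 fun j => ?_
  rcases j with j | j
  · simp only [affineRegressor, Sum.elim_inl]
    fun_prop
  · simp only [affineRegressor, Sum.elim_inr]
    fun_prop

lemma exp_neg_sq_sqrt_two_mul_log {r : ℝ} (hr : 1 ≤ r) :
    Real.exp (-√(2 * Real.log r) ^ 2 / 2) = r⁻¹ := by
  rw [Real.sq_sqrt (by have := Real.log_nonneg hr; positivity),
    show -(2 * Real.log r) / 2 = -Real.log r by ring, Real.exp_neg, Real.exp_log (by linarith)]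

lemma sqrt_two_mul_log_pos {r : ℝ} (hr : 1 < r) : 0 < √(2 * Real.log r) :=
  Real.sqrt_pos.2 (by have := Real.log_pos hr; positivity)

/-- Pass to the complement of a measurable hull of `Gᶜ`: the data are only almost everywhere
measurable, so `G` need not be measurable. -/
lemma exists_measurableSet_of_measure_compl_le {Ω : Type*} [MeasurableSpace Ω] {P : Measure Ω}
    [IsProbabilityMeasure P] {δ : ℝ} (hδ : 0 ≤ δ) {G : Set Ω} (h : P Gᶜ ≤ ENNReal.ofReal δ) :
    ∃ E : Set Ω, MeasurableSet E ∧ ENNReal.ofReal (1 - δ) ≤ P E ∧ E ⊆ G := by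
  refine ⟨(toMeasurable P Gᶜ)ᶜ, (measurableSet_toMeasurable _ _).compl, ?_, ?_⟩
  · rw [prob_compl_eq_one_sub (measurableSet_toMeasurable _ _), measure_toMeasurable,
      ENNReal.ofReal_sub _ hδ, ENNReal.ofReal_one]
    gcongr
  · exact Set.compl_subset_comm.1 (subset_toMeasurable P Gᶜ)

end BilinearID

theorem mainTheorem4 {nx nu : ℕ}
    -- the unknown system, the noise level, the failure probability and the sample sizes
    (A : Matrix (Fin nx) (Fin nx) ℝ) (B₀ : Matrix (Fin nx) (Fin nu) ℝ)
    (B : Fin nu → Matrix (Fin nx) (Fin nx) ℝ)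
    (σw : ℝ) (hσw : 0 < σw) (δ : ℝ) (hδ : δ ∈ Set.Ioo (0 : ℝ) 1)
    (T : Fin (nu + 1) → ℕ) (hT₀ : nx ≤ T 0) (hT : ∀ i : Fin nu, nx + 1 ≤ T i.succ)
    {Ω : Type*} [MeasurableSpace Ω] (P : Measure Ω) [IsProbabilityMeasure P]
    -- sampled states and noise in each of the `nu + 1` experiments
    (x w : (i : Fin (nu + 1)) → Fin (T i) → Ω → EuclideanSpace ℝ (Fin nx))
    (hindep : ∀ i, iIndepFun (fun t ω => (x i t ω, w i t ω)) P)
    (hident : ∀ i s t, IdentDistrib (x i s) (x i t) P P)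
    (hxw : ∀ i t, IndepFun (x i t) (w i t) P)
    (hw : ∀ i t, HasLaw (w i t)
      (multivariateGaussian 0 (σw ^ 2 • (1 : Matrix (Fin nx) (Fin nx) ℝ))) P)
    -- the successor states produced by the bilinear system under the input of the experiment
    (xplus : (i : Fin (nu + 1)) → Fin (T i) → Ω → EuclideanSpace ℝ (Fin nx))
    (hxplus : ∀ i t ω, xplus i t ω =
      BilinearID.step A B₀ B (x i t ω) (BilinearID.input i) (w i t ω))
    -- the ordinary least squares estimates
    (Ahat : Ω → Matrix (Fin nx) (Fin nx) ℝ) (B₀hat : Ω → Matrix (Fin nx) (Fin nu) ℝ)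
    (Bhat : Fin nu → Ω → Matrix (Fin nx) (Fin nx) ℝ)
    (hAhat : ∀ ω, BilinearID.IsOLS (fun t => (x 0 t ω).ofLp) (fun t => xplus 0 t ω) (Ahat ω))
    (hBhat : ∀ i ω, BilinearID.IsOLS (fun t => BilinearID.affineRegressor (x i.succ t ω))
      (fun t => xplus i.succ t ω) (BilinearID.appendCol (Bhat i ω) ((B₀hat ω).col i))) :
    ∃ E : Set Ω, MeasurableSet E ∧ ENNReal.ofReal (1 - δ) ≤ P E ∧ ∀ ω ∈ E,
      BilinearID.LeScaledInv ((Ahat ω - A)ᵀ * (Ahat ω - A))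
        (σw ^ 2 * (2 * √(nx : ℝ) + √(2 * Real.log (2 / δ))) ^ 2)
        (BilinearID.gram_posSemidef (fun t => (x 0 t ω).ofLp)) ∧
      ∀ i : Fin nu,
        BilinearID.LeScaledInv
          ((BilinearID.appendCol (Bhat i ω - B i) ((B₀hat ω - B₀).col i))ᵀ *
            BilinearID.appendCol (Bhat i ω - B i) ((B₀hat ω - B₀).col i))
          (σw ^ 2 * (√((nx : ℝ) + 1) + √(nx : ℝ) + √(2 * Real.log (2 * nu / δ))) ^ 2)
          (BilinearID.gram_posSemidef
            (fun t => BilinearID.affineRegressor (x i.succ t ω))) := by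
  have hδ0 : 0 < δ := hδ.1
  have hδ1 : δ < 1 := hδ.2
  have hxm : ∀ i t, AEMeasurable (x i t) P := fun i t => (hident i t t).aemeasurable_fst
  set s₀ := √(2 * Real.log (2 / δ)) with hs₀
  set s₁ := √(2 * Real.log (2 * nu / δ)) with hs₁
  have hr₀ : 1 < 2 / δ := by rw [lt_div_iff₀ hδ0]; linarith
  have hr₁ : 0 < nu → 1 < 2 * nu / δ := fun h => by
    have : (1 : ℝ) ≤ nu := by exact_mod_cast h
    rw [lt_div_iff₀ hδ0]
    linarith
  set G₀ : Set Ω := {ω | ∀ u, ‖∑ t, ((x 0 t ω).ofLp ⬝ᵥ u) • w 0 t ω‖ ≤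
    σw * (√nx + √(Fintype.card (Fin nx)) + s₀) *
      ‖WithLp.toLp 2 fun t => (x 0 t ω).ofLp ⬝ᵥ u‖} with hG₀
  set G₁ : Fin nu → Set Ω := fun i =>
    {ω | ∀ u, ‖∑ t, (BilinearID.affineRegressor (x i.succ t ω) ⬝ᵥ u) • w i.succ t ω‖ ≤
      σw * (√nx + √(Fintype.card (Fin nx ⊕ Unit)) + s₁) *
        ‖WithLp.toLp 2 fun t => BilinearID.affineRegressor (x i.succ t ω) ⬝ᵥ u‖} with hG₁
  have hP₀ : P G₀ᶜ ≤ ENNReal.ofReal (δ / 2) := by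
    refine (BilinearID.measure_exists_norm_sum_noise_gt_le hσw
      (BilinearID.sqrt_two_mul_log_pos hr₀) (φ := fun x => x.ofLp) (by fun_prop) (hxm 0)
      (hindep 0) (hxw 0) (hw 0)).trans_eq ?_
    rw [BilinearID.exp_neg_sq_sqrt_two_mul_log hr₀.le, inv_div]
  have hP₁ : ∀ i, P (G₁ i)ᶜ ≤ ENNReal.ofReal (δ / (2 * nu)) := fun i => by
    have hr := hr₁ i.pos
    refine (BilinearID.measure_exists_norm_sum_noise_gt_le hσw
      (BilinearID.sqrt_two_mul_log_pos hr) BilinearID.measurable_affineRegressor (hxm i.succ)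
      (hindep i.succ) (hxw i.succ) (hw i.succ)).trans_eq ?_
    rw [BilinearID.exp_neg_sq_sqrt_two_mul_log hr.le, inv_div]
  -- Half of `δ` goes to experiment `0`, the other half is shared equally by the rest; for `nu = 0`
  -- only the first half is spent.
  have hP : P (G₀ ∩ ⋂ i, G₁ i)ᶜ ≤ ENNReal.ofReal δ := by
    rw [Set.compl_inter, Set.compl_iInter]
    calc P (G₀ᶜ ∪ ⋃ i, (G₁ i)ᶜ) ≤ P G₀ᶜ + ∑ i, P (G₁ i)ᶜ :=
          (measure_union_le _ _).trans (add_le_add le_rfl (measure_iUnion_fintype_le P _))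
      _ ≤ ENNReal.ofReal (δ / 2) + ∑ _i : Fin nu, ENNReal.ofReal (δ / (2 * nu)) :=
          add_le_add hP₀ (Finset.sum_le_sum fun i _ => hP₁ i)
      _ = ENNReal.ofReal (δ / 2 + nu * (δ / (2 * nu))) := by
          rw [ENNReal.ofReal_add (by positivity) (by positivity),
            ENNReal.ofReal_mul (by positivity)]
          simp
      _ ≤ ENNReal.ofReal δ := by
          refine ENNReal.ofReal_le_ofReal ?_
          rcases Nat.eq_zero_or_pos nu with h | h
          · simp [h]
            linarith
          · have : (0 : ℝ) < nu := by exact_mod_cast h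
            refine le_of_eq ?_
            field_simp
            ring
  obtain ⟨E, hEm, hPE, hEG⟩ := BilinearID.exists_measurableSet_of_measure_compl_le hδ0.le hP
  refine ⟨E, hEm, hPE, fun ω hω => ⟨?_, fun i => ?_⟩⟩
  · have hs : 0 < s₀ := BilinearID.sqrt_two_mul_log_pos hr₀
    have h := (hAhat ω).leScaledInv (Θ' := A) (w := fun t => w 0 t ω)
      (fun t => by rw [hxplus, BilinearID.step_zero]) (by positivity) (hEG hω).1
    rw [Fintype.card_fin, ← two_mul, mul_pow] at h
    exact h
  · have hs : 0 < s₁ := BilinearID.sqrt_two_mul_log_pos (hr₁ i.pos)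
    have h := (hBhat i ω).leScaledInv (Θ' := BilinearID.appendCol (B i) (B₀.col i))
      (w := fun t => w i.succ t ω) (fun t => by rw [hxplus, BilinearID.step_succ]) (by positivity)
      (Set.mem_iInter.1 (hEG hω).2 i)
    rw [Fintype.card_sum, Fintype.card_fin, Fintype.card_unit, mul_pow,
      add_comm (√(nx : ℝ)) (√((nx + 1 : ℕ) : ℝ)), Nat.cast_add, Nat.cast_one,
      ← BilinearID.appendCol_sub] at h
    exact h
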